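/- For $m,n\ge 0$ let $h_m(n)$ be the number of Hamiltonian cycles of the grid graph $P_m\times P_n$; cycles are counted as subgraphs, so the starting vertex and the direction do not matter, a cycle has at least three vertices, and $h_m(0)=h_m(1)=0$. A $2\times 2$ block of zeros and ones is called *allowed* if it is neither constant nor one of the two checkerboards $\begin{pmatrix}1&0\\0&1\end{pmatrix}$, $\begin{pmatrix}0&1\\1&0\end{pmatrix}$. A binary $m\times n$ matrix is called *good* if, after bordering it by zeros on all four sides, all its $2\times2$ blocks of consecutive rows and columns are allowed, and its ones, joined when they are horizontally or vertically adjacent, form a tree. For $k\ge 1$ consider pairs $[v,S]$ with $v\in\{0,1\}^k$ and $S$ a set partition of $\{i: v_i=1\}$. In the following, two columns are called *compatible* if all $2\times 2$ blocks of the $k\times 2$ matrix formed by them, bordered by a row of zeros above and below, are allowed. - $[v,S]$ is a *starter* if $0$ and $v$ (in this order) are compatible and the blocks of $S$ are the maximal runs of consecutive ones of $v$. - $[v,S]$ is an *ender* if $v$ and $0$ are compatible and $S$ has exactly one block. - $[v',S']$ is a *follower* of $[v,S]$ if $v$ and $v'$ are compatible and the following holds for the graph whose vertices are the blocks of $S$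 and the positions of the ones of $v'$, where consecutive positions are adjacent and a position $i$ is adjacent to the block of $S$ that contains $i$, if any: the graph has no cycle, every block of $S$ is adjacent to some position, and the blocks of $S'$ are the sets of positions that lie in the same connected component. Let $G_k$ be the directed graph whose vertices are $\mathrm{START}$, $\mathrm{END}$ and all pairs $[v,S]$ that can be reached from a starter by repeatedly passing to a follower. Its edges lead from $\mathrm{START}$ to all starters, from each letter $[v,S]$ to all its followers, and from all enders to $\mathrm{END}$. Let $M_k$ be its adjacency matrix, and for $m\ge 2$ put $$\mathrm{GF}_m(z)=\bigl((I-zM_{m-1})^{-1}\bigr)_{\mathrm{START},\,\mathrm{END}}\in\mathbb{Q}(z).$$ Then: 1. For all $m,n\ge 1$, the map that sends a good $m\times n$ matrix, whose entries are placed in the $mn$ unit cells of the grid $P_{m+1}\times P_{n+1}$, to the set of those edges of the grid that separate a one from a zero (cells outside the grid counting as zeros) is a bijection from the good $m\times n$ binary matrices onto the Hamiltonian cycles of $P_{m+1}\times P_{n+1}$. 2. For every $m\ge 2$ (in particular for all $2\le m\le 10$), the rational function $\mathrm{GF}_m(z)$ is the generating function of the numbers of Hamiltonian cycles of the grid graphs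 of width $m$: its expansion at $z=0$ is $\sum_{n\ge 0}h_m(n)z^n$. 3. In particular, for $m=4$ and $m=5$, $$\mathrm{GF}_4(z)=-\frac{z^{2}}{z^{4}-2z^{3}+2z^{2}+2z-1},\qquad \mathrm{GF}_5(z)=-\frac{z^{2}(3z^{2}+1)}{2z^{6}+11z^{2}-1}.$$ -/

import Mathlib

namespace GridHam

/-! ### Hamiltonian cycles of grid graphs -/

/-- The grid graph `P_m × P_n` (Cartesian product of two paths); `(i, j)` is the vertex in
row `i` and column `j`. -/
abbrev gridGraph (m n : ℕ) : SimpleGraph (Fin m × Fin n) :=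
  (SimpleGraph.pathGraph m).boxProd (SimpleGraph.pathGraph n)

/-- The Hamiltonian cycles of `G` as subgraphs: a cycle is identified with its set of edges, so
that neither a starting vertex nor a direction is distinguished. -/
def hamiltonianCycles {V : Type*} [DecidableEq V] (G : SimpleGraph V) : Set (Set (Sym2 V)) :=
  {E | ∃ (a : V) (p : G.Walk a a), p.IsHamiltonianCycle ∧ {e | e ∈ p.edges} = E}

/-- The number of Hamiltonian cycles of `P_m × P_n`. -/
noncomputable def numHamCycles (m n : ℕ) : ℕ :=
  (hamiltonianCycles (gridGraph m n)).ncard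

/-! ### Binary matrices encoding Hamiltonian cycles -/

/-- A binary column `v` of height `m` (rows numbered `1, …, m`), extended by zeros. -/
def padCol {m : ℕ} (v : Fin m → Bool) (a : ℕ) : Bool :=
  if h : 1 ≤ a ∧ a ≤ m then v ⟨a - 1, by omega⟩ else false

/-- A binary `m × n` matrix (rows `1, …, m`, columns `1, …, n`), extended by zeros. -/
def pad {m n : ℕ} (A : Matrix (Fin m) (Fin n) Bool) (a b : ℕ) : Bool :=
  padCol (fun i => padCol (A i) b) a

/-- The `2 × 2` windows with rows `p q` and `r s` that may occur: neither constant nor one of the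
two checkerboards. -/
def Window (p q r s : Bool) : Prop :=
  ¬ (p = q ∧ q = r ∧ r = s) ∧ ¬ (p = s ∧ q = r ∧ p ≠ q)

/-- The `m × n` binary matrices that encode the Hamiltonian cycles of `P_(m+1) × P_(n+1)`: every
`2 × 2` window of the matrix bordered by zeros is allowed (there is one such window for each vertex
of `P_(m+1) × P_(n+1)`), and the ones, joined horizontally and vertically, form a tree. -/
def IsGoodMatrix {m n : ℕ} (A : Matrix (Fin m) (Fin n) Bool) : Prop :=
  (∀ a b : ℕ, a ≤ m → b ≤ n →
    Window (pad A a b) (pad A a (b + 1)) (pad A (a + 1) b) (pad A (a + 1) (b + 1))) ∧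
  ((gridGraph m n).induce {c | A c.1 c.2 = true}).IsTree

/-- The entries of an `m × n` matrix are the unit cells of `P_(m+1) × P_(n+1)`. These are the edges
separating a one from a zero, the cells outside the grid counting as zeros. -/
def boundaryEdges {m n : ℕ} (A : Matrix (Fin m) (Fin n) Bool) :
    Set (Sym2 (Fin (m + 1) × Fin (n + 1))) :=
  {e | (∃ (a : Fin (m + 1)) (b : Fin n), e = s((a, b.castSucc), (a, b.succ)) ∧
          pad A a.val (b.val + 1) ≠ pad A (a.val + 1) (b.val + 1)) ∨
       (∃ (a : Fin m) (b : Fin (n + 1)), e = s((a.castSucc, b), (a.succ, b)) ∧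
          pad A (a.val + 1) b.val ≠ pad A (a.val + 1) (b.val + 1))}

/-! ### The letters `[v, S]` and the directed graph -/

/-- A pair `[v, S]`: a binary column `v` of height `k` and a set partition `S` of the set of
positions of its ones. -/
abbrev Letter (k : ℕ) : Type :=
  Σ v : Fin k → Bool, Finpartition (Finset.univ.filter fun i => v i = true)

/-- `L` can be the first letter: `L.1` is allowed next to a column of zeros, and two ones are in the
same block exactly when they belong to the same run of consecutive ones. -/
def IsStarter {k : ℕ} (L : Letter k) : Prop :=
  (∀ a ≤ k, Window false (padCol L.1 a) false (padCol L.1 (a + 1))) ∧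
  ∀ i j : Fin k, i ≤ j →
    ((∃ B ∈ L.2.parts, i ∈ B ∧ j ∈ B) ↔ ∀ l : Fin k, i ≤ l → l ≤ j → L.1 l = true)

/-- `L` can be the last letter: a column of zeros is allowed next to `L.1`, and all ones are in the
same block. -/
def IsEnder {k : ℕ} (L : Letter k) : Prop :=
  (∀ a ≤ k, Window (padCol L.1 a) false (padCol L.1 (a + 1)) false) ∧ L.2.parts.card = 1

/-- How the ones of a column `v` are joined to each other and to the blocks of the preceding
letter `L`: consecutive ones of `v` are adjacent, and a one of `v` in row `i` is adjacent to the
block of `L` containing `i`, if there is one. -/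
def mergeGraph {k : ℕ} (L : Letter k) (v : Fin k → Bool) :
    SimpleGraph (Fin k ⊕ Finset (Fin k)) :=
  SimpleGraph.fromRel fun x y =>
    match x, y with
    | Sum.inl i, Sum.inl j => i.val + 1 = j.val ∧ v i = true ∧ v j = true
    | Sum.inl i, Sum.inr B => B ∈ L.2.parts ∧ i ∈ B ∧ v i = true
    | _, _ => False

/-- The letter `L'` can follow the letter `L`: the columns are compatible, no cycle of ones is
closed, every block of `L` is continued, and the blocks of `L'` are the resulting connected
components. -/
def Follows {k : ℕ} (L L' : Letter k) : Prop :=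
  (∀ a ≤ k, Window (padCol L.1 a) (padCol L'.1 a) (padCol L.1 (a + 1)) (padCol L'.1 (a + 1))) ∧
  (mergeGraph L L'.1).IsAcyclic ∧
  (∀ B ∈ L.2.parts, ∃ i ∈ B, L'.1 i = true) ∧
  ∀ i j : Fin k, L'.1 i = true → L'.1 j = true →
    ((∃ C ∈ L'.2.parts, i ∈ C ∧ j ∈ C) ↔
      (mergeGraph L L'.1).Reachable (Sum.inl i) (Sum.inl j))

/-- The alphabet: the letters that can be reached from a starting letter. -/
def Alphabet (k : ℕ) : Type :=
  {L : Letter k // ∃ S, IsStarter S ∧ Relation.ReflTransGen Follows S L}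

noncomputable instance (k : ℕ) : Fintype (Alphabet k) :=
  @Fintype.ofFinite _ (inferInstanceAs (Finite (Subtype _)))

noncomputable instance (k : ℕ) : DecidableEq (Alphabet k) := Classical.decEq _

/-- The vertices of the directed graph: `START`, the letters of the alphabet, `END`. -/
abbrev SSVertex (k : ℕ) : Type := Unit ⊕ Alphabet k ⊕ Unit

/-- The vertex `START`. -/
abbrev startVertex (k : ℕ) : SSVertex k := Sum.inl ()

/-- The vertex `END`. -/
abbrev endVertex (k : ℕ) : SSVertex k := Sum.inr (Sum.inr ())

/-- The edges of the directed graph. -/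
def SSEdge {k : ℕ} : SSVertex k → SSVertex k → Prop
  | Sum.inl _, Sum.inr (Sum.inl L) => IsStarter L.1
  | Sum.inr (Sum.inl L), Sum.inr (Sum.inl L') => Follows L.1 L'.1
  | Sum.inr (Sum.inl L), Sum.inr (Sum.inr _) => IsEnder L.1
  | _, _ => False

open Classical in
/-- The adjacency matrix of the directed graph. -/
noncomputable def SSMatrix (k : ℕ) : Matrix (SSVertex k) (SSVertex k) (RatFunc ℚ) :=
  Matrix.of fun x y => if SSEdge x y then 1 else 0

/-- The rational function produced by the transfer-matrix method for width `m`: the entry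
`(START, END)` of `(I - z M)⁻¹`, where `M` is the adjacency matrix of the directed graph whose
letters have height `m - 1`. -/
noncomputable def GFnz (m : ℕ) : RatFunc ℚ :=
  (1 - (RatFunc.X : RatFunc ℚ) • SSMatrix (m - 1))⁻¹ (startVertex (m - 1)) (endVertex (m - 1))

end GridHam

/-!
The plane grid has no homology: a subgraph with all degrees even is the boundary of a set of unit
cells (`exists_cells_of_even`), and this set is unique (`boundaryEdges_injective`). A Hamiltonian
cycle is the same as a connected subgraph with all degrees two, and the degrees of a boundary are
all two exactly when all windows of the matrix are allowed. It remains to compare connectedness of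
the boundary with the ones forming a tree. In both directions this is done by parity arguments.

* Let the ones form a tree. If the boundary falls into two parts, the adjacent pairs of ones across
  which one changes from one part to the other form a subgraph of the tree with all degrees even,
  so there are none; hence all corners of all ones lie in the same part
  (`label_eq_of_isGoodMatrix`).
* Let the boundary be connected. The parity with which a cycle of ones encloses the vertices is
  constant along the boundary and zero at the corners of the grid, so there is no cycle
  (`isAcyclic_of_connected_boundaryGraph`). The ones around a vertex belong to one component,
  because checkerboards are excluded, and this component does not change along the boundary, so
  there is only one (`reachable_of_connected_boundaryGraph`).

To count the good matrices, they are read column by column. The letter reached after `j` columns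
records the last of these and how its ones are connected through the first `j` columns. Whether a
further column closes a cycle, and how its ones are connected, may be decided after contracting the
earlier components to points, that is, from the letter alone. This rests on the observation that
adding edges one at a time acts on a partition into components regardless of the graph that carries
the partition (`joinList_iff_reachable`, `isAcyclic_addEdges_iff`), and leads to
`Records.succ_iff_follows`: followers are the records of one more column. As a follower is
determined by its column, good matrices correspond to paths of letters
(`numHamCycles_eq_pathCount`). Starters are treated as the followers of a column of zeros.

The column with index `END` of `(1 - z M)⁻¹` is the solution of the linear system
`x = e + z M x`, where `e` is the unit vector at `END`, in `ℚ(z)` and in every extension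
(`map_GFnz`). In the Laurent series, the path counting series solve it, which gives the expansion
(`coe_GFnz`).

For the widths four and five the system is solved explicitly. Letters are represented by canonical
labellings of the rows, and followers are computed by merging labels
(`Labels.nextCode_eq_some_iff`). Letters with equal path counting series are put into classes,
which are checked by computation to form an equitable partition of the transfer graph; this leaves
one unknown for each class (`GFnz_eq_of_isEquitable`), four for width four and seven for width five.
-/

namespace GridHam

open SimpleGraph

/-! ### Adding edges to a graph one at a time -/

/-- The relation obtained from `r` by joining the classes of `x` and `y`. -/
def joinRel {ι : Type*} (r : ι → ι → Prop) (x y a b : ι) : Prop :=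
  r a b ∨ (r a x ∧ r y b) ∨ (r a y ∧ r x b)

/-- The relation obtained from `r` by joining, one after the other, the two ends of the pairs of
a list. -/
def joinList {ι : Type*} (r : ι → ι → Prop) : List (ι × ι) → ι → ι → Prop
  | [] => r
  | p :: F => joinList (joinRel r p.1 p.2) F

/-- Every pair of the list joins, when its turn comes, two different classes. -/
def JoinsDistinct {ι : Type*} (r : ι → ι → Prop) : List (ι × ι) → Prop
  | [] => True
  | p :: F => ¬ r p.1 p.2 ∧ JoinsDistinct (joinRel r p.1 p.2) F

/-- The graph `G` with the edges `g x — g y` added, for all pairs `(x, y)` of a list. -/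
def addEdges {V ι : Type*} (G : SimpleGraph V) (g : ι → V) : List (ι × ι) → SimpleGraph V
  | [] => G
  | p :: F => addEdges (G ⊔ edge (g p.1) (g p.2)) g F

theorem addEdges_adj {V ι : Type*} (G : SimpleGraph V) (g : ι → V) (F : List (ι × ι)) (u v : V) :
    (addEdges G g F).Adj u v ↔
      G.Adj u v ∨ (u ≠ v ∧ ∃ p ∈ F, s(g p.1, g p.2) = s(u, v)) := by
  induction F generalizing G with
  | nil => simp [addEdges]
  | cons p F ih =>
    rw [addEdges, ih, sup_adj, adj_edge]
    simp only [List.mem_cons, exists_eq_or_imp]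
    tauto

theorem reachable_sup_edge {V : Type*} (G : SimpleGraph V) (x y a b : V) :
    (G ⊔ edge x y).Reachable a b ↔ joinRel G.Reachable x y a b := by
  constructor
  · intro h
    rw [reachable_iff_reflTransGen] at h
    induction h with
    | refl => exact Or.inl (Reachable.refl _)
    | tail _ hbc ih =>
      rename_i b c
      rw [sup_adj, edge_adj] at hbc
      unfold joinRel at ih ⊢
      rcases hbc with hbc | ⟨⟨rfl, rfl⟩ | ⟨rfl, rfl⟩, -⟩
      · have hr := hbc.reachable
        rcases ih with h | ⟨h, h'⟩ | ⟨h, h'⟩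
        · exact Or.inl (h.trans hr)
        · exact Or.inr (Or.inl ⟨h, h'.trans hr⟩)
        · exact Or.inr (Or.inr ⟨h, h'.trans hr⟩)
      · rcases ih with h | ⟨h, h'⟩ | ⟨h, h'⟩
        · exact Or.inr (Or.inl ⟨h, Reachable.refl _⟩)
        · exact Or.inr (Or.inl ⟨h, Reachable.refl _⟩)
        · exact Or.inl h
      · rcases ih with h | ⟨h, h'⟩ | ⟨h, h'⟩
        · exact Or.inr (Or.inr ⟨h, Reachable.refl _⟩)
        · exact Or.inl h
        · exact Or.inr (Or.inr ⟨h, Reachable.refl _⟩)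
  · have hxy : (G ⊔ edge x y).Reachable x y := by
      by_cases h : x = y
      · subst h; exact Reachable.refl _
      · have hadj : (G ⊔ edge x y).Adj x y :=
          Or.inr ((edge_adj x y x y).2 ⟨Or.inl ⟨rfl, rfl⟩, h⟩)
        exact hadj.reachable
    have hle : G ≤ G ⊔ edge x y := le_sup_left
    rintro (h | ⟨h, h'⟩ | ⟨h, h'⟩)
    · exact h.mono hle
    · exact ((h.mono hle).trans hxy).trans (h'.mono hle)
    · exact ((h.mono hle).trans hxy.symm).trans (h'.mono hle)

theorem joinList_iff_reachable {V ι : Type*} (G : SimpleGraph V) (g : ι → V)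
    (r : ι → ι → Prop) (hr : ∀ a b, r a b ↔ G.Reachable (g a) (g b)) (F : List (ι × ι)) (a b : ι) :
    joinList r F a b ↔ (addEdges G g F).Reachable (g a) (g b) := by
  induction F generalizing G r with
  | nil => exact hr a b
  | cons p F ih =>
    refine ih _ _ fun a b => ?_
    rw [reachable_sup_edge]
    simp only [joinRel, hr]

/-- Whether adding edges closes a cycle depends only on how the endpoints are connected
beforehand. Parallel edges are excluded by the hypotheses `hnew` and `hnodup`, loops by `hne`. -/
theorem isAcyclic_addEdges_iff {V ι : Type*} (G : SimpleGraph V) (g : ι → V)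
    (r : ι → ι → Prop) (hr : ∀ a b, r a b ↔ G.Reachable (g a) (g b)) (F : List (ι × ι))
    (hne : ∀ p ∈ F, g p.1 ≠ g p.2) (hnew : ∀ p ∈ F, ¬ G.Adj (g p.1) (g p.2))
    (hnodup : (F.map fun p => s(g p.1, g p.2)).Nodup) :
    (addEdges G g F).IsAcyclic ↔ G.IsAcyclic ∧ JoinsDistinct r F := by
  induction F generalizing G r with
  | nil => simp [addEdges, JoinsDistinct]
  | cons p F ih =>
    rw [List.map_cons, List.nodup_cons] at hnodup
    rw [addEdges, ih (G ⊔ edge (g p.1) (g p.2)) (joinRel r p.1 p.2) ?_ ?_ ?_ hnodup.2,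
      isAcyclic_sup_fromEdgeSet_iff, JoinsDistinct, hr]
    · have h1 := hne p (by simp)
      have h2 := hnew p (by simp)
      tauto
    · intro a b
      rw [reachable_sup_edge]
      simp only [joinRel, hr]
    · exact fun q hq => hne q (by simp [hq])
    · intro q hq hadj
      rw [sup_adj, adj_edge] at hadj
      rcases hadj with h | h
      · exact hnew q (by simp [hq]) h
      · exact hnodup.1 (List.mem_map.2 ⟨q, hq, h.1.symm⟩)

/-! ### Even subgraphs of forests -/

/-- A forest has no nonempty subgraph with all degrees even: a leaf of a component of the subgraph
would have degree one. -/
theorem not_adj_of_isAcyclic_of_even {V : Type*} [Finite V] {D : SimpleGraph V} (hD : D.IsAcyclic)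
    (heven : ∀ v, Even (D.neighborSet v).ncard) (u v : V) : ¬ D.Adj u v := by
  classical
  cases nonempty_fintype V
  intro huv
  set c := D.connectedComponentMk u with hc
  have hu : u ∈ c := rfl
  have hv : v ∈ c := (ConnectedComponent.sound huv.reachable).symm
  have : Nontrivial c := ⟨⟨u, hu⟩, ⟨v, hv⟩, fun h => huv.ne (congrArg Subtype.val h)⟩
  obtain ⟨w, hw⟩ := (hD.isTree_connectedComponent c).exists_vert_degree_one_of_nontrivial
  have h1 : (D.neighborSet w.1).ncard = 1 := by
    rw [degree_eq_one_iff_existsUnique_adj] at hw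
    obtain ⟨x, hx, hx'⟩ := hw
    rw [Set.ncard_eq_one]
    refine ⟨x.1, Set.ext fun y => ⟨fun hy => ?_, ?_⟩⟩
    · have hyc : y ∈ c := by
        have : D.connectedComponentMk y = D.connectedComponentMk w.1 :=
          ConnectedComponent.sound (Adj.reachable hy).symm
        exact this.trans w.2
      have := hx' ⟨y, hyc⟩ hy
      exact congrArg Subtype.val this
    · rintro rfl
      exact hx
  have := heven w.1
  rw [h1] at this
  exact absurd this (by decide)

/-! ### Subgraphs of grids -/

theorem gridGraph_adj {M N : ℕ} (x y : Fin M × Fin N) :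
    (gridGraph M N).Adj x y ↔
      ((x.1.val + 1 = y.1.val ∨ y.1.val + 1 = x.1.val) ∧ x.2.val = y.2.val) ∨
      ((x.2.val + 1 = y.2.val ∨ y.2.val + 1 = x.2.val) ∧ x.1.val = y.1.val) := by
  rw [boxProd_adj, pathGraph_adj, pathGraph_adj, Fin.ext_iff, Fin.ext_iff]

/-- The horizontal edge from `(a, b - 1)` to `(a, b)` belongs to `D`. In particular `b` is
positive and both ends lie in the grid. -/
def HEdge {M N : ℕ} (D : SimpleGraph (Fin M × Fin N)) (a b : ℕ) : Prop :=
  ∃ x y : Fin M × Fin N, D.Adj x y ∧ x.1.val = a ∧ y.1.val = a ∧ x.2.val + 1 = b ∧ y.2.val = b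

/-- The vertical edge from `(a - 1, b)` to `(a, b)` belongs to `D`. In particular `a` is
positive and both ends lie in the grid. -/
def VEdge {M N : ℕ} (D : SimpleGraph (Fin M × Fin N)) (a b : ℕ) : Prop :=
  ∃ x y : Fin M × Fin N, D.Adj x y ∧ x.2.val = b ∧ y.2.val = b ∧ x.1.val + 1 = a ∧ y.1.val = a

theorem HEdge.bounds {M N : ℕ} {D : SimpleGraph (Fin M × Fin N)} {a b : ℕ} (h : HEdge D a b) :
    a < M ∧ 1 ≤ b ∧ b < N := by
  obtain ⟨x, y, -, rfl, -, h1, rfl⟩ := h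
  exact ⟨x.1.2, by omega, y.2.2⟩

theorem VEdge.bounds {M N : ℕ} {D : SimpleGraph (Fin M × Fin N)} {a b : ℕ} (h : VEdge D a b) :
    b < N ∧ 1 ≤ a ∧ a < M := by
  obtain ⟨x, y, -, rfl, -, h1, rfl⟩ := h
  exact ⟨x.2.2, by omega, y.1.2⟩

theorem hEdge_of_adj {M N : ℕ} {D : SimpleGraph (Fin M × Fin N)} {x y : Fin M × Fin N}
    (h : D.Adj x y) (h1 : x.1.val = y.1.val) (h2 : x.2.val + 1 = y.2.val) :
    HEdge D y.1.val y.2.val := ⟨x, y, h, h1, rfl, h2, rfl⟩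

theorem vEdge_of_adj {M N : ℕ} {D : SimpleGraph (Fin M × Fin N)} {x y : Fin M × Fin N}
    (h : D.Adj x y) (h1 : x.2.val = y.2.val) (h2 : x.1.val + 1 = y.1.val) :
    VEdge D y.1.val y.2.val := ⟨x, y, h, h1, rfl, h2, rfl⟩

theorem HEdge.adj {M N : ℕ} {D : SimpleGraph (Fin M × Fin N)} {x y : Fin M × Fin N}
    (h : HEdge D y.1.val y.2.val) (h1 : x.1.val = y.1.val) (h2 : x.2.val + 1 = y.2.val) :
    D.Adj x y := by
  obtain ⟨x', y', h, a1, a2, a3, a4⟩ := h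
  have hx : x' = x := Prod.ext (Fin.ext (by omega)) (Fin.ext (by omega))
  have hy : y' = y := Prod.ext (Fin.ext (by omega)) (Fin.ext (by omega))
  rwa [hx, hy] at h

theorem VEdge.adj {M N : ℕ} {D : SimpleGraph (Fin M × Fin N)} {x y : Fin M × Fin N}
    (h : VEdge D y.1.val y.2.val) (h1 : x.2.val = y.2.val) (h2 : x.1.val + 1 = y.1.val) :
    D.Adj x y := by
  obtain ⟨x', y', h, a1, a2, a3, a4⟩ := h
  have hx : x' = x := Prod.ext (Fin.ext (by omega)) (Fin.ext (by omega))
  have hy : y' = y := Prod.ext (Fin.ext (by omega)) (Fin.ext (by omega))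
  rwa [hx, hy] at h

/-- Adjacency in a subgraph of a grid in terms of its horizontal and vertical edges. -/
theorem adj_iff_edges {M N : ℕ} {D : SimpleGraph (Fin M × Fin N)} (hD : D ≤ gridGraph M N)
    (x y : Fin M × Fin N) :
    D.Adj x y ↔
      (x.1.val = y.1.val ∧ x.2.val + 1 = y.2.val ∧ HEdge D y.1.val y.2.val) ∨
      (x.1.val = y.1.val ∧ y.2.val + 1 = x.2.val ∧ HEdge D x.1.val x.2.val) ∨
      (x.2.val = y.2.val ∧ x.1.val + 1 = y.1.val ∧ VEdge D y.1.val y.2.val) ∨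
      (x.2.val = y.2.val ∧ y.1.val + 1 = x.1.val ∧ VEdge D x.1.val x.2.val) := by
  constructor
  · intro h
    have hg := hD h
    rw [gridGraph_adj] at hg
    rcases hg with ⟨h1 | h1, h2⟩ | ⟨h1 | h1, h2⟩
    · exact Or.inr (Or.inr (Or.inl ⟨h2, h1, vEdge_of_adj h h2 h1⟩))
    · exact Or.inr (Or.inr (Or.inr ⟨h2, h1, vEdge_of_adj h.symm h2.symm h1⟩))
    · exact Or.inl ⟨h2, h1, hEdge_of_adj h h2 h1⟩
    · exact Or.inr (Or.inl ⟨h2, h1, hEdge_of_adj h.symm h2.symm h1⟩)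
  · rintro (⟨h2, h1, h⟩ | ⟨h2, h1, h⟩ | ⟨h2, h1, h⟩ | ⟨h2, h1, h⟩)
    · exact h.adj h2 h1
    · exact (h.adj h2.symm h1).symm
    · exact h.adj h2 h1
    · exact (h.adj h2.symm h1).symm

theorem eq_of_edges_iff {M N : ℕ} {D D' : SimpleGraph (Fin M × Fin N)} (hD : D ≤ gridGraph M N)
    (hD' : D' ≤ gridGraph M N) (hH : ∀ a b, HEdge D a b ↔ HEdge D' a b)
    (hV : ∀ a b, VEdge D a b ↔ VEdge D' a b) : D = D' := by
  ext x y
  rw [adj_iff_edges hD, adj_iff_edges hD']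
  simp only [hH, hV]

open Classical in
theorem ncard_eq_ite_of_subsingleton {α : Type*} (s : Set α) (hs : s.Subsingleton) (p : Prop)
    (hp : p ↔ s.Nonempty) : s.ncard = if p then 1 else 0 := by
  rcases hs.eq_empty_or_singleton with rfl | ⟨x, rfl⟩ <;> simp [hp]

open Classical in
/-- The degree of a vertex of a subgraph of a grid, as the number of its edges to the left, to the
right, upwards and downwards. -/
theorem ncard_neighborSet_grid {M N : ℕ} {D : SimpleGraph (Fin M × Fin N)}
    (hD : D ≤ gridGraph M N) (x : Fin M × Fin N) :
    (D.neighborSet x).ncard =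
      (if HEdge D x.1 x.2 then 1 else 0) + (if HEdge D x.1 (x.2 + 1) then 1 else 0) +
      (if VEdge D x.1 x.2 then 1 else 0) + (if VEdge D (x.1 + 1) x.2 then 1 else 0) := by
  have hunion : D.neighborSet x =
      ({y | D.Adj x y ∧ x.1.val = y.1.val ∧ y.2.val + 1 = x.2.val} ∪
        {y | D.Adj x y ∧ x.1.val = y.1.val ∧ x.2.val + 1 = y.2.val}) ∪
      ({y | D.Adj x y ∧ x.2.val = y.2.val ∧ y.1.val + 1 = x.1.val} ∪
        {y | D.Adj x y ∧ x.2.val = y.2.val ∧ x.1.val + 1 = y.1.val}) := by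
    ext y
    simp only [mem_neighborSet, Set.mem_union, Set.mem_ofPred_eq]
    constructor
    · intro h
      have := hD h
      rw [gridGraph_adj] at this
      have h1 : x.1.val = y.1.val ↔ y.1.val = x.1.val := eq_comm
      tauto
    · tauto
  rw [hunion, Set.ncard_union_eq, Set.ncard_union_eq, Set.ncard_union_eq,
    ncard_eq_ite_of_subsingleton _ _ (HEdge D x.1 x.2),
    ncard_eq_ite_of_subsingleton _ _ (HEdge D x.1 (x.2 + 1)),
    ncard_eq_ite_of_subsingleton _ _ (VEdge D x.1 x.2),
    ncard_eq_ite_of_subsingleton _ _ (VEdge D (x.1 + 1) x.2), ← add_assoc]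
  · constructor
    · rintro ⟨x', y', h, h1, h2, h3, h4⟩
      have : x' = x := Prod.ext (Fin.ext (by omega)) (Fin.ext (by omega))
      subst this
      exact ⟨y', h, by omega, by omega⟩
    · rintro ⟨y, h, h1, h2⟩
      exact ⟨x, y, h, by omega, by omega, by omega, by omega⟩
  · rintro y ⟨-, h1, h2⟩ z ⟨-, h3, h4⟩
    exact Prod.ext (Fin.ext (by omega)) (Fin.ext (by omega))
  · constructor
    · rintro ⟨y', x', h, h1, h2, h3, h4⟩
      have : x' = x := Prod.ext (Fin.ext (by omega)) (Fin.ext (by omega))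
      subst this
      exact ⟨y', h.symm, by omega, by omega⟩
    · rintro ⟨y, h, h1, h2⟩
      exact ⟨y, x, h.symm, by omega, by omega, by omega, by omega⟩
  · rintro y ⟨-, h1, h2⟩ z ⟨-, h3, h4⟩
    exact Prod.ext (Fin.ext (by omega)) (Fin.ext (by omega))
  · constructor
    · rintro ⟨x', y', h, h1, h2, h3, h4⟩
      have : x' = x := Prod.ext (Fin.ext (by omega)) (Fin.ext (by omega))
      subst this
      exact ⟨y', h, by omega, by omega⟩
    · rintro ⟨y, h, h1, h2⟩
      exact ⟨x, y, h, by omega, by omega, by omega, by omega⟩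
  · rintro y ⟨-, h1, h2⟩ z ⟨-, h3, h4⟩
    exact Prod.ext (Fin.ext (by omega)) (Fin.ext (by omega))
  · constructor
    · rintro ⟨y', x', h, h1, h2, h3, h4⟩
      have : x' = x := Prod.ext (Fin.ext (by omega)) (Fin.ext (by omega))
      subst this
      exact ⟨y', h.symm, by omega, by omega⟩
    · rintro ⟨y, h, h1, h2⟩
      exact ⟨y, x, h.symm, by omega, by omega, by omega, by omega⟩
  · rintro y ⟨-, h1, h2⟩ z ⟨-, h3, h4⟩
    exact Prod.ext (Fin.ext (by omega)) (Fin.ext (by omega))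
  all_goals
    rw [Set.disjoint_left]
    simp only [Set.mem_union, Set.mem_ofPred_eq]
    intro y
    omega

theorem even_ite_sum_iff (p q r s : Prop) [Decidable p] [Decidable q] [Decidable r]
    [Decidable s] :
    Even ((if p then 1 else 0) + (if q then 1 else 0) + (if r then 1 else 0) +
      (if s then 1 else 0)) ↔
      (decide p ^^ decide q ^^ decide r ^^ decide s) = false := by
  by_cases p <;> by_cases q <;> by_cases r <;> by_cases s <;> simp [*] <;> decide

/-- The plane grid has no homology: a subgraph with all degrees even is the boundary of a set `w`
of unit cells. The cells are numbered from `1`, so that `(a, b)` is a common corner of the cells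
`(a, b)`, `(a, b + 1)`, `(a + 1, b)` and `(a + 1, b + 1)`; the cell `(a, b)` is in the set when the
number of vertical edges to its left is odd. -/
theorem exists_cells_of_even {M N : ℕ} {D : SimpleGraph (Fin M × Fin N)} (hD : D ≤ gridGraph M N)
    (heven : ∀ x, Even (D.neighborSet x).ncard) :
    ∃ w : ℕ → ℕ → Bool,
      (∀ a b, ¬ (1 ≤ a ∧ a < M ∧ 1 ≤ b ∧ b < N) → w a b = false) ∧
      (∀ a b, HEdge D a b ↔ w a b ≠ w (a + 1) b) ∧
      (∀ a b, VEdge D a b ↔ w a b ≠ w a (b + 1)) := by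
  classical
  have hev : ∀ a b, (decide (HEdge D a b) ^^ decide (HEdge D a (b + 1)) ^^
      decide (VEdge D a b) ^^ decide (VEdge D (a + 1) b)) = false := by
    intro a b
    by_cases h : a < M ∧ b < N
    · have := heven (⟨a, h.1⟩, ⟨b, h.2⟩)
      rw [ncard_neighborSet_grid hD, even_ite_sum_iff] at this
      exact this
    · have h1 : ¬ HEdge D a b := fun h' => by have := h'.bounds; omega
      have h2 : ¬ HEdge D a (b + 1) := fun h' => by have := h'.bounds; omega
      have h3 : ¬ VEdge D a b := fun h' => by have := h'.bounds; omega
      have h4 : ¬ VEdge D (a + 1) b := fun h' => by have := h'.bounds; omega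
      simp [h1, h2, h3, h4]
  let w : ℕ → ℕ → Bool := fun a b =>
    Nat.rec false (fun j x => x ^^ decide (VEdge D a j)) b
  have hw0 : ∀ a, w a 0 = false := fun a => rfl
  have hw1 : ∀ a b, w a (b + 1) = (w a b ^^ decide (VEdge D a b)) := fun a b => rfl
  have hH : ∀ a b, decide (HEdge D a b) = (w a b ^^ w (a + 1) b) := by
    intro a b
    induction b with
    | zero =>
      have : ¬ HEdge D a 0 := fun h' => by have := h'.bounds; omega
      simp [this, hw0]
    | succ b ih =>
      have := hev a b
      rw [ih] at this
      rw [hw1, hw1]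
      have key : ∀ p q r s t : Bool, ((s ^^ t) ^^ p ^^ q ^^ r) = false →
          p = ((s ^^ q) ^^ (t ^^ r)) := by decide
      exact key _ _ _ _ _ this
  have hH' : ∀ a b, HEdge D a b ↔ w a b ≠ w (a + 1) b := by
    intro a b
    rw [← decide_eq_true_iff (p := HEdge D a b), hH]
    simp
  have hV' : ∀ a b, VEdge D a b ↔ w a b ≠ w a (b + 1) := by
    intro a b
    rw [hw1]
    by_cases h : VEdge D a b <;> simp [h]
  have hrow : ∀ a b, (a = 0 ∨ M ≤ a) → w a b = false := by
    intro a b ha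
    induction b with
    | zero => rfl
    | succ b ih =>
      have : ¬ VEdge D a b := fun h' => by have := h'.bounds; omega
      rw [hw1, ih]
      simp [this]
  have hcol : ∀ a b, N ≤ b → w a b = false := by
    intro a b hb
    induction a with
    | zero => exact hrow 0 b (Or.inl rfl)
    | succ a ih =>
      have : ¬ HEdge D a b := fun h' => by have := h'.bounds; omega
      rw [hH', not_not, ih] at this
      exact this.symm
  refine ⟨w, fun a b h => ?_, hH', hV'⟩
  by_cases h1 : a = 0 ∨ M ≤ a
  · exact hrow a b h1
  · by_cases h2 : b = 0
    · rw [h2]; exact hw0 a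
    · exact hcol a b (by omega)

/-! ### The two graphs attached to a binary matrix -/

theorem padCol_succ {m : ℕ} (v : Fin m → Bool) (i : Fin m) : padCol v (i.val + 1) = v i := by
  simp [padCol]

theorem padCol_eq_false {m : ℕ} (v : Fin m → Bool) (a : ℕ) (h : ¬ (1 ≤ a ∧ a ≤ m)) :
    padCol v a = false := dif_neg h

theorem padCol_eq_true {m : ℕ} {v : Fin m → Bool} {a : ℕ} (h : padCol v a = true) :
    ∃ i : Fin m, i.val + 1 = a ∧ v i = true := by
  by_cases ha : 1 ≤ a ∧ a ≤ m
  · rw [padCol, dif_pos ha] at h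
    exact ⟨_, Nat.sub_add_cancel ha.1, h⟩
  · rw [padCol_eq_false v a ha] at h
    exact absurd h (by decide)

theorem pad_succ {m n : ℕ} (A : Matrix (Fin m) (Fin n) Bool) (x : Fin m × Fin n) :
    pad A (x.1.val + 1) (x.2.val + 1) = A x.1 x.2 := by
  rw [pad, padCol_succ, padCol_succ]

theorem pad_eq_true {m n : ℕ} {A : Matrix (Fin m) (Fin n) Bool} {a b : ℕ}
    (h : pad A a b = true) :
    ∃ x : Fin m × Fin n, x.1.val + 1 = a ∧ x.2.val + 1 = b ∧ A x.1 x.2 = true := by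
  obtain ⟨i, hi, h⟩ := padCol_eq_true h
  obtain ⟨j, hj, h⟩ := padCol_eq_true h
  exact ⟨(i, j), hi, hj, h⟩

theorem pad_eq_false {m n : ℕ} (A : Matrix (Fin m) (Fin n) Bool) {a b : ℕ}
    (h : ¬ (1 ≤ a ∧ a ≤ m ∧ 1 ≤ b ∧ b ≤ n)) : pad A a b = false := by
  by_contra h'
  obtain ⟨x, hx, hy, -⟩ := pad_eq_true (Bool.eq_true_of_not_eq_false h')
  have := x.1.2
  have := x.2.2
  omega

/-- The ones of a binary matrix, joined horizontally and vertically. The zeros are isolated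
vertices of this graph. -/
def onesGraph {m n : ℕ} (A : Matrix (Fin m) (Fin n) Bool) : SimpleGraph (Fin m × Fin n) where
  Adj x y := (gridGraph m n).Adj x y ∧ A x.1 x.2 = true ∧ A y.1 y.2 = true
  symm := ⟨fun _ _ h => ⟨h.1.symm, h.2.2, h.2.1⟩⟩
  loopless := ⟨fun x h => (gridGraph m n).loopless.irrefl x h.1⟩

theorem onesGraph_le {m n : ℕ} (A : Matrix (Fin m) (Fin n) Bool) : onesGraph A ≤ gridGraph m n :=
  fun _ _ h => h.1

theorem hEdge_onesGraph {m n : ℕ} (A : Matrix (Fin m) (Fin n) Bool) (a b : ℕ) :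
    HEdge (onesGraph A) a b ↔ pad A (a + 1) b = true ∧ pad A (a + 1) (b + 1) = true := by
  constructor
  · rintro ⟨x, y, h, rfl, h1, h2, rfl⟩
    rw [← h2, pad_succ, h2, ← h1, pad_succ]
    exact h.2
  · rintro ⟨h, h'⟩
    obtain ⟨x, hx1, hx2, hx⟩ := pad_eq_true h
    obtain ⟨y, hy1, hy2, hy⟩ := pad_eq_true h'
    refine ⟨x, y, ⟨?_, hx, hy⟩, by omega, by omega, by omega, by omega⟩
    rw [gridGraph_adj]
    omega

theorem vEdge_onesGraph {m n : ℕ} (A : Matrix (Fin m) (Fin n) Bool) (a b : ℕ) :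
    VEdge (onesGraph A) a b ↔ pad A a (b + 1) = true ∧ pad A (a + 1) (b + 1) = true := by
  constructor
  · rintro ⟨x, y, h, rfl, h1, h2, rfl⟩
    rw [← h2, pad_succ, h2, ← h1, pad_succ]
    exact h.2
  · rintro ⟨h, h'⟩
    obtain ⟨x, hx1, hx2, hx⟩ := pad_eq_true h
    obtain ⟨y, hy1, hy2, hy⟩ := pad_eq_true h'
    refine ⟨x, y, ⟨?_, hx, hy⟩, by omega, by omega, by omega, by omega⟩
    rw [gridGraph_adj]
    omega

/-- The graph induced on the ones, as a subgraph of the graph that has the zeros as isolated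
vertices. -/
def inducedOnesHom {m n : ℕ} (A : Matrix (Fin m) (Fin n) Bool) :
    (gridGraph m n).induce {c | A c.1 c.2 = true} →g onesGraph A where
  toFun := Subtype.val
  map_rel' {a b} hab := ⟨hab, a.2, b.2⟩

theorem reachable_induce_iff {m n : ℕ} (A : Matrix (Fin m) (Fin n) Bool)
    (x y : {c : Fin m × Fin n | A c.1 c.2 = true}) :
    ((gridGraph m n).induce {c | A c.1 c.2 = true}).Reachable x y ↔
      (onesGraph A).Reachable x.1 y.1 := by
  constructor
  · intro h
    exact h.map (inducedOnesHom A)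
  · obtain ⟨x, hx⟩ := x
    obtain ⟨y, hy⟩ := y
    intro h
    rw [reachable_iff_reflTransGen] at h
    dsimp only at h
    induction h with
    | refl => exact Reachable.refl _
    | tail _ hbc ih =>
      refine (ih hbc.2.1).trans (Adj.reachable ?_)
      exact hbc.1

/-- A matrix is good when its windows are allowed and its graph of ones is acyclic and connected,
apart from the isolated zeros. -/
theorem isGoodMatrix_iff {m n : ℕ} (A : Matrix (Fin m) (Fin n) Bool) :
    IsGoodMatrix A ↔
      (∀ a b : ℕ, a ≤ m → b ≤ n →
        Window (pad A a b) (pad A a (b + 1)) (pad A (a + 1) b) (pad A (a + 1) (b + 1))) ∧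
      (onesGraph A).IsAcyclic ∧ (∃ x : Fin m × Fin n, A x.1 x.2 = true) ∧
      ∀ x y : Fin m × Fin n, A x.1 x.2 = true → A y.1 y.2 = true →
        (onesGraph A).Reachable x y := by
  rw [IsGoodMatrix]
  refine and_congr_right fun _ => ?_
  constructor
  · intro h
    refine ⟨?_, ?_, ?_⟩
    · intro u p hp
      have hs : ∀ w ∈ (p.mapLe (onesGraph_le A)).support,
          w ∈ {c : Fin m × Fin n | A c.1 c.2 = true} := by
        intro w hw
        rw [Walk.support_mapLe_eq_support] at hw
        obtain ⟨z, hz⟩ := Set.nonempty_of_ncard_ne_zero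
          (by rw [hp.ncard_neighborSet_toSubgraph_eq_two hw]; decide)
        exact (Subgraph.adj_sub _ hz).2.1
      refine h.isAcyclic ((p.mapLe (onesGraph_le A)).induce _ hs) ?_
      rw [← Walk.isCycle_map_iff_of_injective (f := (Embedding.induce _).toHom)
        Subtype.val_injective, Walk.map_induce]
      exact hp.mapLe _
    · obtain ⟨x, hx⟩ := h.connected.nonempty
      exact ⟨x, hx⟩
    · intro x y hx hy
      exact (reachable_induce_iff A ⟨x, hx⟩ ⟨y, hy⟩).1 (h.connected.preconnected _ _)
  · rintro ⟨h1, ⟨x, hx⟩, h2⟩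
    have : Nonempty {c : Fin m × Fin n | A c.1 c.2 = true} := ⟨⟨x, hx⟩⟩
    refine ⟨⟨fun x y => (reachable_induce_iff A x y).2 (h2 _ _ x.2 y.2)⟩, ?_⟩
    exact h1.comap (inducedOnesHom A) Subtype.val_injective

/-- The graph on the vertices of the grid whose edges separate the ones from the zeros. -/
def boundaryGraph {m n : ℕ} (A : Matrix (Fin m) (Fin n) Bool) :
    SimpleGraph (Fin (m + 1) × Fin (n + 1)) :=
  fromEdgeSet (boundaryEdges A)

theorem edgeSet_boundaryGraph {m n : ℕ} (A : Matrix (Fin m) (Fin n) Bool) :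
    (boundaryGraph A).edgeSet = boundaryEdges A := by
  rw [boundaryGraph, edgeSet_fromEdgeSet, sdiff_eq_left, Set.disjoint_left]
  rintro e (⟨a, b, rfl, -⟩ | ⟨a, b, rfl, -⟩) h
  · simp [Fin.ext_iff] at h
  · simp [Fin.ext_iff] at h

theorem boundaryGraph_adj {m n : ℕ} (A : Matrix (Fin m) (Fin n) Bool)
    (x y : Fin (m + 1) × Fin (n + 1)) :
    (boundaryGraph A).Adj x y ↔ s(x, y) ∈ boundaryEdges A := by
  rw [← edgeSet_boundaryGraph, mem_edgeSet]

theorem boundaryGraph_le {m n : ℕ} (A : Matrix (Fin m) (Fin n) Bool) :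
    boundaryGraph A ≤ gridGraph (m + 1) (n + 1) := by
  intro x y h
  rw [boundaryGraph_adj] at h
  rw [gridGraph_adj]
  rcases h with ⟨a, b, h, -⟩ | ⟨a, b, h, -⟩ <;>
  · rw [Sym2.eq_iff] at h
    rcases h with ⟨rfl, rfl⟩ | ⟨rfl, rfl⟩ <;> simp

theorem hEdge_boundaryGraph {m n : ℕ} (A : Matrix (Fin m) (Fin n) Bool) (a b : ℕ) :
    HEdge (boundaryGraph A) a b ↔ pad A a b ≠ pad A (a + 1) b := by
  constructor
  · rintro ⟨x, y, h, rfl, h1, h2, rfl⟩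
    rw [boundaryGraph_adj] at h
    rcases h with ⟨a, b, h, h'⟩ | ⟨a, b, h, -⟩
    · rw [Sym2.eq_iff] at h
      rcases h with ⟨rfl, rfl⟩ | ⟨rfl, rfl⟩
      · simpa using h'
      · simp at h2
        omega
    · rw [Sym2.eq_iff] at h
      rcases h with ⟨rfl, rfl⟩ | ⟨rfl, rfl⟩ <;> simp at h2
  · intro h
    have h1 : a < m + 1 ∧ 1 ≤ b ∧ b ≤ n := by
      by_contra h'
      rw [pad_eq_false A (by omega), pad_eq_false A (by omega)] at h
      exact h rfl
    obtain ⟨b, rfl⟩ := Nat.exists_eq_add_of_le' h1.2.1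
    refine ⟨(⟨a, h1.1⟩, (⟨b, by omega⟩ : Fin n).castSucc),
      (⟨a, h1.1⟩, (⟨b, by omega⟩ : Fin n).succ), ?_, rfl, rfl, rfl, rfl⟩
    rw [boundaryGraph_adj]
    exact Or.inl ⟨_, _, rfl, h⟩

theorem vEdge_boundaryGraph {m n : ℕ} (A : Matrix (Fin m) (Fin n) Bool) (a b : ℕ) :
    VEdge (boundaryGraph A) a b ↔ pad A a b ≠ pad A a (b + 1) := by
  constructor
  · rintro ⟨x, y, h, rfl, h1, h2, rfl⟩
    rw [boundaryGraph_adj] at h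
    rcases h with ⟨a, b, h, -⟩ | ⟨a, b, h, h'⟩
    · rw [Sym2.eq_iff] at h
      rcases h with ⟨rfl, rfl⟩ | ⟨rfl, rfl⟩ <;> simp at h2
    · rw [Sym2.eq_iff] at h
      rcases h with ⟨rfl, rfl⟩ | ⟨rfl, rfl⟩
      · simpa using h'
      · simp at h2
        omega
  · intro h
    have h1 : b < n + 1 ∧ 1 ≤ a ∧ a ≤ m := by
      by_contra h'
      rw [pad_eq_false A (by omega), pad_eq_false A (by omega)] at h
      exact h rfl
    obtain ⟨a, rfl⟩ := Nat.exists_eq_add_of_le' h1.2.1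
    refine ⟨((⟨a, by omega⟩ : Fin m).castSucc, ⟨b, h1.1⟩),
      ((⟨a, by omega⟩ : Fin m).succ, ⟨b, h1.1⟩), ?_, rfl, rfl, rfl, rfl⟩
    rw [boundaryGraph_adj]
    exact Or.inr ⟨_, _, rfl, h⟩

/-- The window at a vertex is allowed exactly when the vertex has two boundary edges: a constant
window gives none, a checkerboard four. -/
theorem window_iff_ncard_eq_two {m n : ℕ} (A : Matrix (Fin m) (Fin n) Bool)
    (x : Fin (m + 1) × Fin (n + 1)) :
    Window (pad A x.1 x.2) (pad A x.1 (x.2 + 1)) (pad A (x.1 + 1) x.2)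
      (pad A (x.1 + 1) (x.2 + 1)) ↔ ((boundaryGraph A).neighborSet x).ncard = 2 := by
  classical
  rw [ncard_neighborSet_grid (boundaryGraph_le A)]
  simp only [hEdge_boundaryGraph, vEdge_boundaryGraph]
  generalize pad A x.1 x.2 = p
  generalize pad A x.1 (x.2 + 1) = q
  generalize pad A (x.1 + 1) x.2 = r
  generalize pad A (x.1 + 1) (x.2 + 1) = s
  cases p <;> cases q <;> cases r <;> cases s <;> simp [Window]

/-! ### Hamiltonian cycles as connected graphs of degree two -/

/-- The Hamiltonian cycles are the edge sets of the connected spanning subgraphs in which every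
vertex has degree two. -/
theorem mem_hamiltonianCycles_iff {V : Type*} [Finite V] [DecidableEq V]
    (G : SimpleGraph V) (E : Set (Sym2 V)) :
    E ∈ hamiltonianCycles G ↔
      ∃ D ≤ G, D.Connected ∧ (∀ v, (D.neighborSet v).ncard = 2) ∧ D.edgeSet = E := by
  constructor
  · rintro ⟨a, p, hp, rfl⟩
    refine ⟨p.toSubgraph.spanningCoe, Subgraph.spanningCoe_le _, ?_, fun v => ?_, ?_⟩
    · have hv : ∀ v, v ∈ p.toSubgraph.verts := fun v =>
        p.mem_verts_toSubgraph.2 (hp.mem_support v)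
      have hc := p.toSubgraph_connected
      have : Nonempty V := ⟨a⟩
      refine ⟨fun x y => ?_⟩
      have := (Subgraph.connected_iff'.1 hc).preconnected ⟨x, hv x⟩ ⟨y, hv y⟩
      exact this.map ⟨Subtype.val, fun {a b} hab => hab⟩
    · exact hp.isCycle.ncard_neighborSet_toSubgraph_eq_two (hp.mem_support v)
    · ext e
      rw [Subgraph.edgeSet_spanningCoe, Walk.mem_edges_toSubgraph]
      rfl
  · rintro ⟨D, hle, hconn, hdeg, rfl⟩
    obtain ⟨a⟩ := hconn.nonempty
    have hcyc : D.IsCycles := fun v _ => hdeg v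
    have hne : (D.neighborSet a).Nonempty :=
      Set.nonempty_of_ncard_ne_zero (by rw [hdeg]; decide)
    obtain ⟨p, hp, hpv⟩ := hcyc.exists_cycle_toSubgraph_verts_eq_connectedComponentSupp
      (c := D.connectedComponentMk a) rfl hne
    have hall : ∀ v, v ∈ p.support := fun v => by
      rw [← p.mem_verts_toSubgraph, hpv]
      exact ConnectedComponent.sound (hconn.preconnected v a)
    refine ⟨a, p.mapLe hle, ?_, ?_⟩
    · rw [Walk.isHamiltonianCycle_iff_isCycle_and_support_count_tail_eq_one]
      refine ⟨hp.mapLe hle, fun v => ?_⟩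
      rw [Walk.support_mapLe_eq_support]
      refine List.count_eq_one_of_mem hp.support_nodup ?_
      have hv := hall v
      rw [← p.cons_tail_support, List.mem_cons] at hv
      rcases hv with rfl | hv
      · exact Walk.end_mem_tail_support hp.not_nil
      · exact hv
    · rw [Walk.edges_mapLe_eq_edges]
      ext e
      refine ⟨fun he => p.edges_subset_edgeSet he, ?_⟩
      induction e with | h u v => ?_
      intro huv
      -- both neighbours of `u` are already neighbours along the cycle
      have hsub : p.toSubgraph.neighborSet u ⊆ D.neighborSet u := fun w hw => hw.adj_sub
      have heq := Set.eq_of_subset_of_ncard_le hsub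
        (by rw [hdeg, hp.ncard_neighborSet_toSubgraph_eq_two (hall u)])
      have : v ∈ p.toSubgraph.neighborSet u := heq ▸ huv
      exact (Walk.mem_edges_toSubgraph p).1 this

/-! ### Good matrices and Hamiltonian cycles -/

/-- The subgraph of `D` formed by the horizontal edges satisfying `h` and the vertical edges
satisfying `v`. -/
def filterEdges {M N : ℕ} (D : SimpleGraph (Fin M × Fin N)) (h v : ℕ → ℕ → Prop) :
    SimpleGraph (Fin M × Fin N) where
  Adj x y := D.Adj x y ∧
    ((x.1.val = y.1.val ∧ x.2.val + 1 = y.2.val ∧ h y.1 y.2) ∨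
      (x.1.val = y.1.val ∧ y.2.val + 1 = x.2.val ∧ h x.1 x.2) ∨
      (x.2.val = y.2.val ∧ x.1.val + 1 = y.1.val ∧ v y.1 y.2) ∨
      (x.2.val = y.2.val ∧ y.1.val + 1 = x.1.val ∧ v x.1 x.2))
  symm := ⟨fun x y hxy => ⟨hxy.1.symm, by
    have h1 : x.1.val = y.1.val ↔ y.1.val = x.1.val := eq_comm
    have h2 : x.2.val = y.2.val ↔ y.2.val = x.2.val := eq_comm
    have := hxy.2
    tauto⟩⟩
  loopless := ⟨fun x h => D.loopless.irrefl x h.1⟩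

theorem filterEdges_le {M N : ℕ} (D : SimpleGraph (Fin M × Fin N)) (h v : ℕ → ℕ → Prop) :
    filterEdges D h v ≤ D := fun _ _ h => h.1

theorem hEdge_filterEdges {M N : ℕ} (D : SimpleGraph (Fin M × Fin N)) (h v : ℕ → ℕ → Prop)
    (a b : ℕ) : HEdge (filterEdges D h v) a b ↔ HEdge D a b ∧ h a b := by
  constructor
  · rintro ⟨x, y, hxy, rfl, h1, h2, rfl⟩
    refine ⟨⟨x, y, hxy.1, rfl, h1, h2, rfl⟩, ?_⟩
    rcases hxy.2 with h' | h' | h' | h'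
    · rw [← h1]; exact h'.2.2
    all_goals omega
  · rintro ⟨⟨x, y, hxy, rfl, h1, h2, rfl⟩, h3⟩
    exact ⟨x, y, ⟨hxy, Or.inl ⟨h1.symm, h2, h1 ▸ h3⟩⟩, rfl, h1, h2, rfl⟩

theorem vEdge_filterEdges {M N : ℕ} (D : SimpleGraph (Fin M × Fin N)) (h v : ℕ → ℕ → Prop)
    (a b : ℕ) : VEdge (filterEdges D h v) a b ↔ VEdge D a b ∧ v a b := by
  constructor
  · rintro ⟨x, y, hxy, rfl, h1, h2, rfl⟩
    refine ⟨⟨x, y, hxy.1, rfl, h1, h2, rfl⟩, ?_⟩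
    rcases hxy.2 with h' | h' | h' | h'
    rotate_left 2
    · rw [← h1]; exact h'.2.2
    all_goals omega
  · rintro ⟨⟨x, y, hxy, rfl, h1, h2, rfl⟩, h3⟩
    exact ⟨x, y, ⟨hxy, Or.inr (Or.inr (Or.inl ⟨h1.symm, h2, h1 ▸ h3⟩))⟩, rfl, h1, h2, rfl⟩

/-- A two-valued labelling of the vertices that is constant along the boundary edges is constant,
if the ones form a forest and are connected. Around a one, the label changes an even number of
times, and only across edges that separate it from another one; hence the pairs of adjacent ones
across which the label changes form an even subgraph of the forest of ones, which is empty. -/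
theorem label_eq_of_isGoodMatrix {m n : ℕ} {A : Matrix (Fin m) (Fin n) Bool}
    (hA : IsGoodMatrix A) (κ : ℕ → ℕ → Bool)
    (hH : ∀ a b, HEdge (boundaryGraph A) a (b + 1) → κ a b = κ a (b + 1))
    (hV : ∀ a b, VEdge (boundaryGraph A) (a + 1) b → κ a b = κ (a + 1) b)
    (a b a' b' : ℕ) (ha : a ≤ m) (hb : b ≤ n) (ha' : a' ≤ m) (hb' : b' ≤ n) :
    κ a b = κ a' b' := by
  classical
  obtain ⟨hwin, hacyc, -, hconn⟩ := (isGoodMatrix_iff A).1 hA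
  simp only [hEdge_boundaryGraph] at hH
  simp only [vEdge_boundaryGraph] at hV
  set D := filterEdges (onesGraph A) (fun a b => κ a b ≠ κ (a + 1) b)
    (fun a b => κ a b ≠ κ a (b + 1)) with hD
  have hDle : D ≤ onesGraph A := filterEdges_le _ _ _
  have hDH : ∀ a b, HEdge D a b ↔
      (pad A (a + 1) b = true ∧ pad A (a + 1) (b + 1) = true) ∧ κ a b ≠ κ (a + 1) b := fun a b => by
    rw [hD, hEdge_filterEdges, hEdge_onesGraph]
  have hDV : ∀ a b, VEdge D a b ↔
      (pad A a (b + 1) = true ∧ pad A (a + 1) (b + 1) = true) ∧ κ a b ≠ κ a (b + 1) := fun a b => by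
    rw [hD, vEdge_filterEdges, vEdge_onesGraph]
  have heven : ∀ x, Even (D.neighborSet x).ncard := by
    intro x
    rw [ncard_neighborSet_grid (hDle.trans (onesGraph_le A)), even_ite_sum_iff]
    simp only [hDH, hDV]
    have h1 := hV x.1 x.2
    have h2 := hV x.1 (x.2 + 1)
    have h3 := hH x.1 x.2
    have h4 := hH (x.1 + 1) x.2
    generalize κ x.1 x.2 = k1 at *
    generalize κ (x.1 + 1) x.2 = k2 at *
    generalize κ x.1 (x.2 + 1) = k3 at *
    generalize κ (x.1 + 1) (x.2 + 1) = k4 at *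
    generalize pad A (x.1 + 1) (x.2 + 1) = p at *
    generalize pad A (x.1 + 1) x.2 = p1 at *
    generalize pad A (x.1 + 1) (x.2 + 1 + 1) = p2 at *
    generalize pad A x.1 (x.2 + 1) = p3 at *
    generalize pad A (x.1 + 1 + 1) (x.2 + 1) = p4 at *
    clear * - h1 h2 h3 h4
    revert k1 k2 k3 k4 p p1 p2 p3 p4
    decide
  have hempty := not_adj_of_isAcyclic_of_even (hacyc.anti hDle) heven
  have hnoH : ∀ a b, pad A (a + 1) b = true → pad A (a + 1) (b + 1) = true →
      κ a b = κ (a + 1) b := by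
    intro a b h1 h2
    by_contra h
    obtain ⟨x, y, hxy, -⟩ := (hDH a b).2 ⟨⟨h1, h2⟩, h⟩
    exact hempty x y hxy
  have hnoV : ∀ a b, pad A a (b + 1) = true → pad A (a + 1) (b + 1) = true →
      κ a b = κ a (b + 1) := by
    intro a b h1 h2
    by_contra h
    obtain ⟨x, y, hxy, -⟩ := (hDV a b).2 ⟨⟨h1, h2⟩, h⟩
    exact hempty x y hxy
  -- all corners of a one have the same label
  have hcorner : ∀ a b, pad A (a + 1) (b + 1) = true →
      κ (a + 1) b = κ a b ∧ κ a (b + 1) = κ a b ∧ κ (a + 1) (b + 1) = κ a b := by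
    intro a b h
    have e1 : κ a b = κ (a + 1) b := by
      by_cases h' : pad A (a + 1) b = true
      · exact hnoH a b h' h
      · exact hV a b fun e => h' (e.trans h)
    have e2 : κ a b = κ a (b + 1) := by
      by_cases h' : pad A a (b + 1) = true
      · exact hnoV a b h' h
      · exact hH a b fun e => h' (e.trans h)
    have e3 : κ a (b + 1) = κ (a + 1) (b + 1) := by
      by_cases h' : pad A (a + 1) (b + 1 + 1) = true
      · exact hnoH a (b + 1) h h'
      · exact hV a (b + 1) fun e => h' (e.symm.trans h)
    exact ⟨e1.symm, e2.symm, (e2.trans e3).symm⟩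
  have hcell : ∀ x y : Fin m × Fin n, A x.1 x.2 = true → A y.1 y.2 = true →
      κ x.1 x.2 = κ y.1 y.2 := by
    intro x y hx hy
    have hr := hconn x y hx hy
    rw [reachable_iff_reflTransGen] at hr
    induction hr with
    | refl => rfl
    | @tail u v _ hbc ih =>
      refine (ih hbc.2.1).trans ?_
      have hu := hcorner u.1 u.2 (by rw [pad_succ]; exact hbc.2.1)
      have hv := hcorner v.1 v.2 (by rw [pad_succ]; exact hbc.2.2)
      have hg := hbc.1
      rw [gridGraph_adj] at hg
      rcases hg with ⟨h1 | h1, h2⟩ | ⟨h1 | h1, h2⟩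
      · rw [← h1, ← h2]; exact hu.1.symm
      · rw [← h1, h2]; exact hv.1
      · rw [← h1, ← h2]; exact hu.2.1.symm
      · rw [← h1, h2]; exact hv.2.1
  -- every vertex is a corner of some one
  have hvertex : ∀ a b, a ≤ m → b ≤ n →
      ∃ x : Fin m × Fin n, A x.1 x.2 = true ∧ κ a b = κ x.1 x.2 := by
    intro a b ha hb
    have hw := (hwin a b ha hb).1
    have : pad A a b = true ∨ pad A a (b + 1) = true ∨ pad A (a + 1) b = true ∨
        pad A (a + 1) (b + 1) = true := by
      clear * - hw
      generalize pad A a b = p at *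
      generalize pad A a (b + 1) = q at *
      generalize pad A (a + 1) b = r at *
      generalize pad A (a + 1) (b + 1) = s at *
      revert p q r s
      decide
    rcases this with h | h | h | h <;>
      obtain ⟨x, hx1, hx2, hx⟩ := pad_eq_true h <;>
      refine ⟨x, hx, ?_⟩ <;>
      have hc := hcorner x.1 x.2 (by rw [pad_succ]; exact hx)
    · rw [← hx1, ← hx2]; exact hc.2.2
    · rw [← hx1, ← Nat.succ_injective hx2]; exact hc.1
    · rw [← hx2, ← Nat.succ_injective hx1]; exact hc.2.1
    · rw [← Nat.succ_injective hx2, ← Nat.succ_injective hx1]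
  obtain ⟨x, hx, hx'⟩ := hvertex a b ha hb
  obtain ⟨y, hy, hy'⟩ := hvertex a' b' ha' hb'
  rw [hx', hy', hcell x y hx hy]

theorem connected_boundaryGraph {m n : ℕ} {A : Matrix (Fin m) (Fin n) Bool}
    (hA : IsGoodMatrix A) : (boundaryGraph A).Connected := by
  classical
  refine ⟨fun u v => ?_⟩
  -- label the vertices by whether they are connected to `u`
  have hκ : ∀ (y : Fin (m + 1) × Fin (n + 1)) (a b : ℕ), y.1.val = a → y.2.val = b →
      ((∃ z, z.1.val = a ∧ z.2.val = b ∧ (boundaryGraph A).Reachable u z) ↔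
        (boundaryGraph A).Reachable u y) := by
    rintro y a b rfl rfl
    refine ⟨?_, fun h => ⟨y, rfl, rfl, h⟩⟩
    rintro ⟨z, h1, h2, h⟩
    rwa [show z = y from Prod.ext (Fin.ext h1) (Fin.ext h2)] at h
  have := label_eq_of_isGoodMatrix hA (fun a b => decide
    (∃ z, z.1.val = a ∧ z.2.val = b ∧ (boundaryGraph A).Reachable u z))
    (by
      rintro a b ⟨x, y, hxy, h1, h2, h3, h4⟩
      rw [decide_eq_decide, hκ x a b h1 (by omega), hκ y a (b + 1) h2 h4]
      exact ⟨fun h => h.trans hxy.reachable, fun h => h.trans hxy.reachable.symm⟩)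
    (by
      rintro a b ⟨x, y, hxy, h1, h2, h3, h4⟩
      rw [decide_eq_decide, hκ x a b (by omega) h1, hκ y (a + 1) b h4 h2]
      exact ⟨fun h => h.trans hxy.reachable, fun h => h.trans hxy.reachable.symm⟩)
    u.1 u.2 v.1 v.2 (by omega) (by omega) (by omega) (by omega)
  rw [decide_eq_decide, hκ u _ _ rfl rfl, hκ v _ _ rfl rfl] at this
  exact this.1 (Reachable.refl _)

theorem boundaryEdges_mem_hamiltonianCycles {m n : ℕ} {A : Matrix (Fin m) (Fin n) Bool}
    (hA : IsGoodMatrix A) :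
    boundaryEdges A ∈ hamiltonianCycles (gridGraph (m + 1) (n + 1)) :=
  (mem_hamiltonianCycles_iff _ _).2 ⟨boundaryGraph A, boundaryGraph_le A,
    connected_boundaryGraph hA,
    fun x => (window_iff_ncard_eq_two A x).1 (hA.1 _ _ (by omega) (by omega)),
    edgeSet_boundaryGraph A⟩

/-- If the boundary of a set of ones is connected, then the ones form no cycle: the parity with
which a cycle of ones encloses the vertices is constant along the boundary, and it is zero at the
corners of the grid. -/
theorem isAcyclic_of_connected_boundaryGraph {m n : ℕ} {A : Matrix (Fin m) (Fin n) Bool}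
    (hconn : (boundaryGraph A).Connected) : (onesGraph A).IsAcyclic := by
  intro u p hp
  set D := p.toSubgraph.spanningCoe with hD
  have hDle : D ≤ onesGraph A := Subgraph.spanningCoe_le _
  have heven : ∀ x, Even (D.neighborSet x).ncard := by
    intro x
    rcases (D.neighborSet x).eq_empty_or_nonempty with h | h
    · simp [h]
    · rw [hp.isCycles_spanningCoe_toSubgraph h]
      decide
  obtain ⟨w, hw0, hwH, hwV⟩ := exists_cells_of_even (hDle.trans (onesGraph_le A)) heven
  have hconst : ∀ x y : Fin (m + 1) × Fin (n + 1), (boundaryGraph A).Reachable x y →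
      w x.1 x.2 = w y.1 y.2 := by
    intro x y h
    rw [reachable_iff_reflTransGen] at h
    induction h with
    | refl => rfl
    | @tail y z _ hyz ih =>
      refine ih.trans ?_
      -- a boundary edge has a zero on one side, so the cycle of ones does not cross it
      have hcross : ∀ a b, HEdge (boundaryGraph A) a (b + 1) → w a b = w a (b + 1) := by
        intro a b h
        by_contra h'
        obtain ⟨s, t, hst, h1⟩ := (hwV a b).2 h'
        have h2 := (vEdge_onesGraph A a b).1 ⟨s, t, hDle hst, h1⟩
        exact (hEdge_boundaryGraph A a (b + 1)).1 h (h2.1.trans h2.2.symm)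
      have hcross' : ∀ a b, VEdge (boundaryGraph A) (a + 1) b → w a b = w (a + 1) b := by
        intro a b h
        by_contra h'
        obtain ⟨s, t, hst, h1⟩ := (hwH a b).2 h'
        have h2 := (hEdge_onesGraph A a b).1 ⟨s, t, hDle hst, h1⟩
        exact (vEdge_boundaryGraph A (a + 1) b).1 h (h2.1.trans h2.2.symm)
      rcases (adj_iff_edges (boundaryGraph_le A) y z).1 hyz with
        ⟨h1, h2, h⟩ | ⟨h1, h2, h⟩ | ⟨h1, h2, h⟩ | ⟨h1, h2, h⟩
      · rw [← h2] at h ⊢; rw [h1]; exact hcross _ _ h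
      · rw [← h2] at h ⊢; rw [← h1]; exact (hcross _ _ h).symm
      · rw [← h2] at h ⊢; rw [h1]; exact hcross' _ _ h
      · rw [← h2] at h ⊢; rw [← h1]; exact (hcross' _ _ h).symm
  have hzero : ∀ a b, w a b = false := by
    intro a b
    by_cases h : a < m + 1 ∧ b < n + 1
    · have := hconst (⟨a, h.1⟩, ⟨b, h.2⟩) (⟨0, by omega⟩, ⟨0, by omega⟩)
        (hconn.preconnected _ _)
      exact this.trans (hw0 0 0 (by omega))
    · exact hw0 a b (by omega)
  have hadj : D.Adj u p.snd := p.toSubgraph_adj_snd hp.not_nil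
  rw [adj_iff_edges (hDle.trans (onesGraph_le A))] at hadj
  simp only [hwH, hwV, hzero, ne_eq, not_true, and_false, or_false] at hadj

/-- If the boundary of a set of ones is connected and all windows are allowed, then the ones are
connected: the ones at a vertex are consecutive in the cyclic order around it, hence belong to one
component, and this component does not change along the boundary. -/
theorem reachable_of_connected_boundaryGraph {m n : ℕ} {A : Matrix (Fin m) (Fin n) Bool}
    (hconn : (boundaryGraph A).Connected)
    (hwin : ∀ a b : ℕ, a ≤ m → b ≤ n →
      Window (pad A a b) (pad A a (b + 1)) (pad A (a + 1) b) (pad A (a + 1) (b + 1)))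
    (s t : Fin m × Fin n) (hs : A s.1 s.2 = true) (ht : A t.1 t.2 = true) :
    (onesGraph A).Reachable s t := by
  -- `c a b` says that the cell `(a, b)` is a one in the component of `s`
  let c : ℕ → ℕ → Bool := fun a b => @decide (∃ x : Fin m × Fin n,
    x.1.val + 1 = a ∧ x.2.val + 1 = b ∧ A x.1 x.2 = true ∧ (onesGraph A).Reachable s x)
    (Classical.propDecidable _)
  have hc : ∀ (x : Fin m × Fin n) (a b : ℕ), x.1.val + 1 = a → x.2.val + 1 = b →
      A x.1 x.2 = true → (c a b = true ↔ (onesGraph A).Reachable s x) := by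
    rintro x a b rfl rfl hx
    refine (@decide_eq_true_iff _ (Classical.propDecidable _)).trans ⟨?_, fun h => ⟨x, rfl, rfl, hx, h⟩⟩
    rintro ⟨z, h1, h2, -, h⟩
    rwa [show z = x from Prod.ext (Fin.ext (by omega)) (Fin.ext (by omega))] at h
  have hcpad : ∀ a b, pad A a b = false → c a b = false := by
    intro a b h
    refine @decide_eq_false _ (Classical.propDecidable _) ?_
    rintro ⟨x, rfl, rfl, h', -⟩
    rw [pad_succ] at h
    rw [h] at h'
    exact absurd h' (by decide)
  have hcH : ∀ a b, pad A (a + 1) b = true → pad A (a + 1) (b + 1) = true →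
      c (a + 1) b = c (a + 1) (b + 1) := by
    intro a b h h'
    obtain ⟨x, y, hxy, h1, h2, h3, h4⟩ := (hEdge_onesGraph A a b).2 ⟨h, h'⟩
    rw [Bool.eq_iff_iff, hc x _ _ (by omega) h3 hxy.2.1, hc y _ _ (by omega) (by omega) hxy.2.2]
    exact ⟨fun h => h.trans hxy.reachable, fun h => h.trans hxy.reachable.symm⟩
  have hcV : ∀ a b, pad A a (b + 1) = true → pad A (a + 1) (b + 1) = true →
      c a (b + 1) = c (a + 1) (b + 1) := by
    intro a b h h'
    obtain ⟨x, y, hxy, h1, h2, h3, h4⟩ := (vEdge_onesGraph A a b).2 ⟨h, h'⟩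
    rw [Bool.eq_iff_iff, hc x _ _ h3 (by omega) hxy.2.1, hc y _ _ (by omega) (by omega) hxy.2.2]
    exact ⟨fun h => h.trans hxy.reachable, fun h => h.trans hxy.reachable.symm⟩
  -- the label of a vertex: some one at this vertex belongs to the component of `s`
  let l : ℕ → ℕ → Bool := fun a b => c a b || c a (b + 1) || c (a + 1) b || c (a + 1) (b + 1)
  have hl : ∀ a b, a ≤ m → b ≤ n →
      (pad A a b = true → c a b = l a b) ∧ (pad A a (b + 1) = true → c a (b + 1) = l a b) ∧
      (pad A (a + 1) b = true → c (a + 1) b = l a b) ∧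
      (pad A (a + 1) (b + 1) = true → c (a + 1) (b + 1) = l a b) := by
    intro a b ha hb
    have hw := hwin a b ha hb
    have z1 := hcpad a b
    have z2 := hcpad a (b + 1)
    have z3 := hcpad (a + 1) b
    have z4 := hcpad (a + 1) (b + 1)
    have e2 := hcH a b
    have e4 := hcV a b
    have e1 : pad A a b = true → pad A a (b + 1) = true → c a b = c a (b + 1) := by
      intro h h'
      cases a with
      | zero => rw [pad_eq_false A (by omega)] at h; exact absurd h (by decide)
      | succ a => exact hcH a b h h'
    have e3 : pad A a b = true → pad A (a + 1) b = true → c a b = c (a + 1) b := by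
      intro h h'
      cases b with
      | zero => rw [pad_eq_false A (by omega)] at h; exact absurd h (by decide)
      | succ b => exact hcV a b h h'
    simp only [l]
    clear * - hw z1 z2 z3 z4 e1 e2 e3 e4
    unfold Window at hw
    generalize pad A a b = p1 at *
    generalize pad A a (b + 1) = p2 at *
    generalize pad A (a + 1) b = p3 at *
    generalize pad A (a + 1) (b + 1) = p4 at *
    generalize c a b = c1 at *
    generalize c a (b + 1) = c2 at *
    generalize c (a + 1) b = c3 at *
    generalize c (a + 1) (b + 1) = c4 at *
    cases p1 <;> cases p2 <;> cases p3 <;> cases p4 <;> simp_all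
  have hconst : ∀ x y : Fin (m + 1) × Fin (n + 1), (boundaryGraph A).Reachable x y →
      l x.1 x.2 = l y.1 y.2 := by
    intro x y h
    rw [reachable_iff_reflTransGen] at h
    induction h with
    | refl => rfl
    | @tail y z _ hyz ih =>
      refine ih.trans ?_
      -- the two ends of a boundary edge are corners of the one next to this edge
      have hcross : ∀ a b, a ≤ m → b + 1 ≤ n → HEdge (boundaryGraph A) a (b + 1) →
          l a b = l a (b + 1) := by
        intro a b ha hb h
        rw [hEdge_boundaryGraph] at h
        cases h1 : pad A a (b + 1)
        · have h2 : pad A (a + 1) (b + 1) = true := by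
            rw [h1] at h; exact Bool.eq_true_of_not_eq_false fun e => h e.symm
          exact ((hl a b ha (by omega)).2.2.2 h2).symm.trans ((hl a (b + 1) ha hb).2.2.1 h2)
        · exact ((hl a b ha (by omega)).2.1 h1).symm.trans ((hl a (b + 1) ha hb).1 h1)
      have hcross' : ∀ a b, a + 1 ≤ m → b ≤ n → VEdge (boundaryGraph A) (a + 1) b →
          l a b = l (a + 1) b := by
        intro a b ha hb h
        rw [vEdge_boundaryGraph] at h
        cases h1 : pad A (a + 1) b
        · have h2 : pad A (a + 1) (b + 1) = true := by
            rw [h1] at h; exact Bool.eq_true_of_not_eq_false fun e => h e.symm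
          exact ((hl a b (by omega) hb).2.2.2 h2).symm.trans ((hl (a + 1) b ha hb).2.1 h2)
        · exact ((hl a b (by omega) hb).2.2.1 h1).symm.trans ((hl (a + 1) b ha hb).1 h1)
      have := y.1.2
      have := y.2.2
      have := z.1.2
      have := z.2.2
      rcases (adj_iff_edges (boundaryGraph_le A) y z).1 hyz with
        ⟨h1, h2, h⟩ | ⟨h1, h2, h⟩ | ⟨h1, h2, h⟩ | ⟨h1, h2, h⟩
      · rw [← h2] at h ⊢; rw [h1]; exact hcross _ _ (by omega) (by omega) h
      · rw [← h2] at h ⊢; rw [← h1]; exact (hcross _ _ (by omega) (by omega) h).symm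
      · rw [← h2] at h ⊢; rw [h1]; exact hcross' _ _ (by omega) (by omega) h
      · rw [← h2] at h ⊢; rw [← h1]; exact (hcross' _ _ (by omega) (by omega) h).symm
  have hcell : ∀ x : Fin m × Fin n, A x.1 x.2 = true →
      c (x.1 + 1) (x.2 + 1) = l x.1 x.2 := fun x hx =>
    (hl x.1 x.2 (by omega) (by omega)).2.2.2 (by rw [pad_succ]; exact hx)
  have h1 := hconst (s.1.castSucc, s.2.castSucc) (t.1.castSucc, t.2.castSucc)
    (hconn.preconnected _ _)
  have h2 : c (s.1 + 1) (s.2 + 1) = c (t.1 + 1) (t.2 + 1) :=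
    (hcell s hs).trans (h1.trans (hcell t ht).symm)
  rw [(hc s _ _ rfl rfl hs).2 (Reachable.refl _)] at h2
  exact (hc t _ _ rfl rfl ht).1 h2.symm

theorem isGoodMatrix_of_connected_boundaryGraph {m n : ℕ} {A : Matrix (Fin m) (Fin n) Bool}
    (hconn : (boundaryGraph A).Connected)
    (hdeg : ∀ x, ((boundaryGraph A).neighborSet x).ncard = 2) : IsGoodMatrix A := by
  have hwin : ∀ a b : ℕ, a ≤ m → b ≤ n →
      Window (pad A a b) (pad A a (b + 1)) (pad A (a + 1) b) (pad A (a + 1) (b + 1)) :=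
    fun a b ha hb => (window_iff_ncard_eq_two A (⟨a, by omega⟩, ⟨b, by omega⟩)).2 (hdeg _)
  refine (isGoodMatrix_iff A).2 ⟨hwin, isAcyclic_of_connected_boundaryGraph hconn, ?_,
    reachable_of_connected_boundaryGraph hconn hwin⟩
  have h := (hwin 0 0 (by omega) (by omega)).1
  rw [pad_eq_false A (by omega), pad_eq_false A (by omega), pad_eq_false A (by omega)] at h
  obtain ⟨x, -, -, hx⟩ := pad_eq_true (A := A) (a := 0 + 1) (b := 0 + 1)
    (Bool.eq_true_of_not_eq_false fun e => h ⟨rfl, rfl, e.symm⟩)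
  exact ⟨x, hx⟩

theorem boundaryEdges_injective {m n : ℕ} :
    Function.Injective (boundaryEdges (m := m) (n := n)) := by
  intro A B h
  have hg : boundaryGraph A = boundaryGraph B := by rw [boundaryGraph, h, boundaryGraph]
  have hV : ∀ a b, pad A a b ≠ pad A a (b + 1) ↔ pad B a b ≠ pad B a (b + 1) := by
    intro a b
    rw [← vEdge_boundaryGraph, ← vEdge_boundaryGraph, hg]
  have hpad : ∀ a b, pad A a b = pad B a b := by
    intro a b
    induction b with
    | zero => rw [pad_eq_false A (by omega), pad_eq_false B (by omega)]
    | succ b ih =>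
      have := hV a b
      rw [ih] at this
      generalize pad B a b = p at *
      generalize pad A a (b + 1) = q at *
      generalize pad B a (b + 1) = r at *
      clear * - this
      revert p q r
      decide
  ext i j
  rw [← pad_succ A (i, j), ← pad_succ B (i, j), hpad]

theorem bijOn_boundaryEdges (m n : ℕ) :
    Set.BijOn (boundaryEdges (m := m) (n := n)) {A | IsGoodMatrix A}
      (hamiltonianCycles (gridGraph (m + 1) (n + 1))) := by
  refine ⟨fun A hA => boundaryEdges_mem_hamiltonianCycles hA, boundaryEdges_injective.injOn, ?_⟩
  intro E hE
  obtain ⟨D, hDle, hconn, hdeg, rfl⟩ := (mem_hamiltonianCycles_iff _ _).1 hE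
  obtain ⟨w, hw0, hwH, hwV⟩ := exists_cells_of_even hDle (fun x => by rw [hdeg]; decide)
  let A : Matrix (Fin m) (Fin n) Bool := fun i j => w (i + 1) (j + 1)
  have hpad : ∀ a b, pad A a b = w a b := by
    intro a b
    by_cases h : 1 ≤ a ∧ a ≤ m ∧ 1 ≤ b ∧ b ≤ n
    · obtain ⟨a, rfl⟩ := Nat.exists_eq_add_of_le' h.1
      obtain ⟨b, rfl⟩ := Nat.exists_eq_add_of_le' h.2.2.1
      exact pad_succ A (⟨a, by omega⟩, ⟨b, by omega⟩)
    · rw [pad_eq_false A h, hw0 a b (by omega)]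
  have hAD : boundaryGraph A = D := by
    refine eq_of_edges_iff (boundaryGraph_le A) hDle (fun a b => ?_) (fun a b => ?_)
    · rw [hEdge_boundaryGraph, hwH, hpad, hpad]
    · rw [vEdge_boundaryGraph, hwV, hpad, hpad]
  refine ⟨A, isGoodMatrix_of_connected_boundaryGraph (hAD ▸ hconn) (hAD ▸ hdeg), ?_⟩
  rw [← edgeSet_boundaryGraph, hAD]

/-! ### Letters -/

/-- The positions `i` and `j` are ones in the same block of the letter `L`. -/
def SameBlock {k : ℕ} (L : Letter k) (i j : Fin k) : Prop :=
  ∃ B ∈ L.2.parts, i ∈ B ∧ j ∈ B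

theorem SameBlock.symm {k : ℕ} {L : Letter k} {i j : Fin k} (h : SameBlock L i j) :
    SameBlock L j i := by
  obtain ⟨B, hB, h1, h2⟩ := h
  exact ⟨B, hB, h2, h1⟩

theorem Letter.eq_true_of_mem {k : ℕ} {L : Letter k} {B : Finset (Fin k)} (hB : B ∈ L.2.parts)
    {i : Fin k} (hi : i ∈ B) : L.1 i = true :=
  (Finset.mem_filter.1 (L.2.le hB hi)).2

theorem SameBlock.eq_true {k : ℕ} {L : Letter k} {i j : Fin k} (h : SameBlock L i j) :
    L.1 i = true ∧ L.1 j = true := by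
  obtain ⟨B, hB, h1, h2⟩ := h
  exact ⟨Letter.eq_true_of_mem hB h1, Letter.eq_true_of_mem hB h2⟩

theorem Letter.part_mem {k : ℕ} (L : Letter k) {i : Fin k} (hi : L.1 i = true) :
    L.2.part i ∈ L.2.parts :=
  L.2.part_mem.2 (by simp [hi])

theorem Letter.mem_part {k : ℕ} (L : Letter k) {i : Fin k} (hi : L.1 i = true) :
    i ∈ L.2.part i :=
  L.2.mem_part (by simp [hi])

theorem Letter.eq_part {k : ℕ} {L : Letter k} {B : Finset (Fin k)} (hB : B ∈ L.2.parts)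
    {i : Fin k} (hi : i ∈ B) : B = L.2.part i :=
  (L.2.part_eq_of_mem hB hi).symm

theorem sameBlock_iff_part_eq {k : ℕ} (L : Letter k) {i j : Fin k} (hi : L.1 i = true)
    (hj : L.1 j = true) : SameBlock L i j ↔ L.2.part i = L.2.part j := by
  constructor
  · rintro ⟨B, hB, h1, h2⟩
    rw [← Letter.eq_part hB h1, ← Letter.eq_part hB h2]
  · intro h
    exact ⟨_, L.part_mem hi, L.mem_part hi, h ▸ L.mem_part hj⟩

theorem Letter.ext_of_sameBlock {k : ℕ} {L L' : Letter k} (h1 : L.1 = L'.1)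
    (h2 : ∀ i j, L.1 i = true → L.1 j = true → (SameBlock L i j ↔ SameBlock L' i j)) :
    L = L' := by
  obtain ⟨v, P⟩ := L
  obtain ⟨v', P'⟩ := L'
  obtain rfl : v = v' := h1
  have key : ∀ P P' : Finpartition (Finset.univ.filter fun i => v i = true),
      (∀ i j, v i = true → v j = true → (SameBlock ⟨v, P⟩ i j ↔ SameBlock ⟨v, P'⟩ i j)) →
      P.parts ⊆ P'.parts := by
    intro P P' h B hB
    obtain ⟨i, hi⟩ := P.nonempty_of_mem_parts hB
    have hvi : v i = true := Letter.eq_true_of_mem (L := ⟨v, P⟩) hB hi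
    have : B = P'.part i := by
      ext j
      constructor
      · intro hj
        obtain ⟨C, hC, h1, h2⟩ := (h i j hvi
          (Letter.eq_true_of_mem (L := ⟨v, P⟩) hB hj)).1 ⟨B, hB, hi, hj⟩
        rwa [← Letter.eq_part (L := ⟨v, P'⟩) hC h1]
      · intro hj
        have hm := Letter.part_mem ⟨v, P'⟩ hvi
        obtain ⟨C, hC, h1, h2⟩ := (h i j hvi
          (Letter.eq_true_of_mem (L := ⟨v, P'⟩) hm hj)).2
          ⟨_, hm, Letter.mem_part ⟨v, P'⟩ hvi, hj⟩
        rwa [Letter.eq_part (L := ⟨v, P⟩) hB hi, ← Letter.eq_part (L := ⟨v, P⟩) hC h1]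
    rw [this]
    exact Letter.part_mem ⟨v, P'⟩ hvi
  have : P = P' := Finpartition.ext (Finset.Subset.antisymm (key P P' h2)
    (key P' P fun i j hi hj => (h2 i j hi hj).symm))
  rw [this]

/-- An equivalence relation on the rows cuts the ones of a column into blocks. -/
theorem exists_letter {k : ℕ} (v : Fin k → Bool) (s : Setoid (Fin k)) :
    ∃ L : Letter k, L.1 = v ∧
      ∀ i j, v i = true → v j = true → (SameBlock L i j ↔ s i j) := by
  classical
  refine ⟨⟨v, Finpartition.ofSetSetoid s _⟩, rfl, fun i j hi hj => ?_⟩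
  rw [sameBlock_iff_part_eq _ hi hj]
  have h := Finpartition.mem_part_ofSetSetoid_iff_rel (s := s)
    (Finset.univ.filter fun i => v i = true) (a := i) (b := j)
  simp only [Finset.mem_filter, Finset.mem_univ, true_and, hi, hj] at h
  rw [← h]
  constructor
  · intro e
    rw [e]
    exact Letter.mem_part ⟨v, Finpartition.ofSetSetoid s _⟩ hj
  · intro e
    exact Letter.eq_part (L := ⟨v, Finpartition.ofSetSetoid s _⟩)
      (Letter.part_mem ⟨v, Finpartition.ofSetSetoid s _⟩ hi) e

/-- A follower is determined by its column. -/
theorem Follows.unique {k : ℕ} {L L' L'' : Letter k} (h' : Follows L L') (h'' : Follows L L'')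
    (h : L'.1 = L''.1) : L' = L'' := by
  refine Letter.ext_of_sameBlock h fun i j hi hj => ?_
  refine (h'.2.2.2 i j hi hj).trans ?_
  rw [h] at hi hj ⊢
  exact (h''.2.2.2 i j hi hj).symm

theorem mergeGraph_adj {k : ℕ} (L : Letter k) (v : Fin k → Bool)
    (x y : Fin k ⊕ Finset (Fin k)) :
    (mergeGraph L v).Adj x y ↔
      (∃ i j : Fin k, i.val + 1 = j.val ∧ v i = true ∧ v j = true ∧
        ((x = Sum.inl i ∧ y = Sum.inl j) ∨ (x = Sum.inl j ∧ y = Sum.inl i))) ∨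
      (∃ i : Fin k, L.1 i = true ∧ v i = true ∧
        ((x = Sum.inl i ∧ y = Sum.inr (L.2.part i)) ∨
          (x = Sum.inr (L.2.part i) ∧ y = Sum.inl i))) := by
  rw [mergeGraph, fromRel_adj]
  constructor
  · rintro ⟨-, h⟩
    rcases x with i | B <;> rcases y with j | C <;> simp only [or_false, false_or] at h
    · rcases h with h | h
      · exact Or.inl ⟨i, j, h.1, h.2.1, h.2.2, Or.inl ⟨rfl, rfl⟩⟩
      · exact Or.inl ⟨j, i, h.1, h.2.1, h.2.2, Or.inr ⟨rfl, rfl⟩⟩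
    · rw [Letter.eq_part h.1 h.2.1]
      exact Or.inr ⟨i, Letter.eq_true_of_mem h.1 h.2.1, h.2.2, Or.inl ⟨rfl, rfl⟩⟩
    · rw [Letter.eq_part h.1 h.2.1]
      exact Or.inr ⟨j, Letter.eq_true_of_mem h.1 h.2.1, h.2.2, Or.inr ⟨rfl, rfl⟩⟩
  · rintro (⟨i, j, h1, h2, h3, ⟨rfl, rfl⟩ | ⟨rfl, rfl⟩⟩ | ⟨i, h1, h2, ⟨rfl, rfl⟩ | ⟨rfl, rfl⟩⟩)
    · refine ⟨fun h => ?_, Or.inl ⟨h1, h2, h3⟩⟩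
      rw [Sum.inl.inj h] at h1
      omega
    · refine ⟨fun h => ?_, Or.inr ⟨h1, h2, h3⟩⟩
      rw [Sum.inl.inj h] at h1
      omega
    · exact ⟨Sum.inl_ne_inr, Or.inl ⟨L.part_mem h1, L.mem_part h1, h2⟩⟩
    · exact ⟨Sum.inr_ne_inl, Or.inr ⟨L.part_mem h1, L.mem_part h1, h2⟩⟩

/-! ### Scanning a matrix column by column -/

/-- The column `j` of a matrix, for columns numbered from `1`; it is zero outside the matrix. -/
def colOf {k n : ℕ} (A : Matrix (Fin k) (Fin n) Bool) (j : ℕ) : Fin k → Bool :=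
  fun i => padCol (A i) j

theorem colOf_eq {k n : ℕ} (A : Matrix (Fin k) (Fin n) Bool) (x : Fin k × Fin n) {j : ℕ}
    (hj : x.2.val + 1 = j) : colOf A j x.1 = A x.1 x.2 := by
  rw [← hj, colOf, padCol_succ]

theorem colOf_eq_true {k n : ℕ} {A : Matrix (Fin k) (Fin n) Bool} {j : ℕ} {i : Fin k}
    (h : colOf A j i = true) :
    ∃ x : Fin k × Fin n, x.1 = i ∧ x.2.val + 1 = j ∧ A x.1 x.2 = true := by
  obtain ⟨b, hb, h⟩ := padCol_eq_true h
  exact ⟨(i, b), rfl, hb, h⟩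

/-- The graph of the ones in the first `j` columns. -/
def partGraph {k n : ℕ} (A : Matrix (Fin k) (Fin n) Bool) (j : ℕ) :
    SimpleGraph (Fin k × Fin n) where
  Adj x y := (onesGraph A).Adj x y ∧ x.2.val < j ∧ y.2.val < j
  symm := ⟨fun _ _ h => ⟨h.1.symm, h.2.2, h.2.1⟩⟩
  loopless := ⟨fun x h => (onesGraph A).loopless.irrefl x h.1⟩

theorem partGraph_mono {k n : ℕ} (A : Matrix (Fin k) (Fin n) Bool) (j : ℕ) :
    partGraph A j ≤ partGraph A (j + 1) :=
  fun _ _ h => ⟨h.1, h.2.1.trans j.lt_succ_self, h.2.2.trans j.lt_succ_self⟩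

theorem partGraph_self {k n : ℕ} (A : Matrix (Fin k) (Fin n) Bool) :
    partGraph A n = onesGraph A := by
  ext x y
  exact ⟨fun h => h.1, fun h => ⟨h, x.2.2, y.2.2⟩⟩

/-- The first `j` columns can be the beginning of a good matrix with more than `j` columns or with
exactly `j` columns: the windows are allowed, there is no cycle, and every component reaches the
column `j`. -/
structure ValidPrefix {k n : ℕ} (A : Matrix (Fin k) (Fin n) Bool) (j : ℕ) : Prop where
  window : ∀ a b : ℕ, a ≤ k → b < j →
    Window (pad A a b) (pad A a (b + 1)) (pad A (a + 1) b) (pad A (a + 1) (b + 1))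
  acyclic : (partGraph A j).IsAcyclic
  reach : ∀ x : Fin k × Fin n, A x.1 x.2 = true → x.2.val < j →
    ∃ y : Fin k × Fin n, A y.1 y.2 = true ∧ y.2.val + 1 = j ∧ (partGraph A j).Reachable x y

/-- The letter `L` records the column `j` and how its ones are connected through the first `j`
columns. -/
structure Records {k n : ℕ} (A : Matrix (Fin k) (Fin n) Bool) (j : ℕ) (L : Letter k) : Prop where
  valid : ValidPrefix A j
  col : L.1 = colOf A j
  block : ∀ x y : Fin k × Fin n, A x.1 x.2 = true → A y.1 y.2 = true → x.2.val + 1 = j →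
    y.2.val + 1 = j → (SameBlock L x.1 y.1 ↔ (partGraph A j).Reachable x y)

theorem eq_of_reachable_partGraph {k n : ℕ} {A : Matrix (Fin k) (Fin n) Bool} {j : ℕ}
    {x y : Fin k × Fin n} (h : (partGraph A j).Reachable x y) (hx : j ≤ x.2.val) : x = y := by
  rw [reachable_iff_reflTransGen] at h
  rcases h.cases_head with h | ⟨z, hz, -⟩
  · exact h
  · exact absurd hz.2.1 (by omega)

/-- A connection from the first `j` columns to the next one leaves the former through two
horizontally adjacent ones. -/
theorem exists_exit {k n : ℕ} {A : Matrix (Fin k) (Fin n) Bool} {j : ℕ} {x y : Fin k × Fin n}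
    (h : (partGraph A (j + 1)).Reachable x y) (hx : x.2.val < j) (hy : y.2.val = j) :
    ∃ z z' : Fin k × Fin n, A z.1 z.2 = true ∧ A z'.1 z'.2 = true ∧ z.1 = z'.1 ∧
      z.2.val + 1 = j ∧ z'.2.val = j ∧ (partGraph A j).Reachable x z := by
  rw [reachable_iff_reflTransGen] at h
  induction h using Relation.ReflTransGen.head_induction_on with
  | refl => omega
  | @head x x' hxx' _ ih =>
    by_cases hx' : x'.2.val < j
    · obtain ⟨z, z', h1, h2, h3, h4, h5, h6⟩ := ih hx'
      have : (partGraph A j).Adj x x' := ⟨hxx'.1, hx, hx'⟩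
      exact ⟨z, z', h1, h2, h3, h4, h5, this.reachable.trans h6⟩
    · have hg := hxx'.1.1
      rw [gridGraph_adj] at hg
      refine ⟨x, x', hxx'.1.2.1, hxx'.1.2.2, Fin.ext ?_, ?_, ?_, Reachable.refl _⟩ <;> omega

theorem ValidPrefix.pred {k n : ℕ} {A : Matrix (Fin k) (Fin n) Bool} {j : ℕ}
    (h : ValidPrefix A (j + 1)) : ValidPrefix A j where
  window a b ha hb := h.window a b ha (by omega)
  acyclic := h.acyclic.anti (partGraph_mono A j)
  reach x hx hxj := by
    obtain ⟨y, -, hyj, hxy⟩ := h.reach x hx (by omega)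
    obtain ⟨z, -, hz, -, -, hzj, -, hxz⟩ := exists_exit hxy hxj (by omega)
    exact ⟨z, hz, hzj, hxz⟩

theorem ValidPrefix.exists_records {k n : ℕ} {A : Matrix (Fin k) (Fin n) Bool} {j : ℕ}
    (h : ValidPrefix A j) : ∃ L, Records A j L := by
  by_cases hj : ∃ c : Fin n, c.val + 1 = j
  · obtain ⟨c, hc⟩ := hj
    obtain ⟨L, hL, hL'⟩ := exists_letter (colOf A j)
      ((partGraph A j).reachableSetoid.comap fun i : Fin k => (i, c))
    refine ⟨L, h, hL, fun x y hx hy hxj hyj => ?_⟩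
    have hxc : x = (x.1, c) := Prod.ext rfl (Fin.ext (by dsimp only; omega))
    have hyc : y = (y.1, c) := Prod.ext rfl (Fin.ext (by dsimp only; omega))
    rw [hL' x.1 y.1 ((colOf_eq A x hxj).trans hx) ((colOf_eq A y hyj).trans hy)]
    conv_rhs => rw [hxc, hyc]
    rfl
  · obtain ⟨L, hL, -⟩ := exists_letter (colOf A j) ⊤
    exact ⟨L, h, hL, fun x _ _ _ hxj _ => absurd ⟨x.2, hxj⟩ hj⟩

/-- The ones of two consecutive columns. -/
abbrev Strip {k n : ℕ} (A : Matrix (Fin k) (Fin n) Bool) (j : ℕ) : Type :=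
  {x : Fin k × Fin n // A x.1 x.2 = true ∧ (x.2.val + 1 = j ∨ x.2.val = j)}

/-- The vertex of `mergeGraph L v` that represents a one of the two columns: a one of the new column
represents itself, a one of the old column its block. -/
def stripVertex {k n : ℕ} {A : Matrix (Fin k) (Fin n) Bool} {j : ℕ} (L : Letter k)
    (x : Strip A j) : Fin k ⊕ Finset (Fin k) :=
  if x.1.2.val = j then Sum.inl x.1.1 else Sum.inr (L.2.part x.1.1)

open Classical in
/-- The adjacent pairs of ones that the column `j + 1` adds to the first `j` columns. -/
noncomputable def stripEdges {k n : ℕ} (A : Matrix (Fin k) (Fin n) Bool) (j : ℕ) :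
    List (Strip A j × Strip A j) :=
  (Finset.univ.filter fun p : Strip A j × Strip A j => p.1.1.2.val = j ∧
    ((p.2.1.2.val = j ∧ p.1.1.1.val + 1 = p.2.1.1.val) ∨
      (p.2.1.2.val + 1 = j ∧ p.1.1.1 = p.2.1.1))).toList

theorem mem_stripEdges {k n : ℕ} {A : Matrix (Fin k) (Fin n) Bool} {j : ℕ}
    {p : Strip A j × Strip A j} :
    p ∈ stripEdges A j ↔ p.1.1.2.val = j ∧
      ((p.2.1.2.val = j ∧ p.1.1.1.val + 1 = p.2.1.1.val) ∨
        (p.2.1.2.val + 1 = j ∧ p.1.1.1 = p.2.1.1)) := by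
  simp [stripEdges]

theorem Records.reachable_iff_stripVertex_eq {k n : ℕ} {A : Matrix (Fin k) (Fin n) Bool} {j : ℕ}
    {L : Letter k} (h : Records A j L) (x y : Strip A j) :
    (partGraph A j).Reachable x.1 y.1 ↔ stripVertex L x = stripVertex L y := by
  have hL : ∀ x : Strip A j, x.1.2.val + 1 = j → L.1 x.1.1 = true := fun x hx => by
    rw [h.col, colOf_eq A x.1 hx]
    exact x.2.1
  unfold stripVertex
  split_ifs with hx hy hy
  · constructor
    · intro hr
      rw [eq_of_reachable_partGraph hr hx.ge]
    · intro e
      rw [show x.1 = y.1 from Prod.ext (Sum.inl.inj e) (Fin.ext (hx.trans hy.symm))]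
  · refine iff_of_false (fun hr => hy ?_) not_false
    rw [← eq_of_reachable_partGraph hr hx.ge]
    exact hx
  · refine iff_of_false (fun hr => hx ?_) not_false
    rw [← eq_of_reachable_partGraph hr.symm hy.ge]
    exact hy
  · have hx' := x.2.2.resolve_right hx
    have hy' := y.2.2.resolve_right hy
    rw [← h.block x.1 y.1 x.2.1 y.2.1 hx' hy', sameBlock_iff_part_eq L (hL x hx') (hL y hy'),
      Sum.inr.injEq]

theorem addEdges_partGraph {k n : ℕ} (A : Matrix (Fin k) (Fin n) Bool) (j : ℕ) :
    addEdges (partGraph A j) Subtype.val (stripEdges A j) = partGraph A (j + 1) := by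
  ext u v
  rw [addEdges_adj]
  constructor
  · rintro (h | ⟨-, p, hp, hpe⟩)
    · exact partGraph_mono A j h
    · have hadj : (partGraph A (j + 1)).Adj p.1.1 p.2.1 := by
        rw [mem_stripEdges] at hp
        refine ⟨⟨?_, p.1.2.1, p.2.2.1⟩, ?_, ?_⟩
        · rw [gridGraph_adj]
          rw [Fin.ext_iff] at hp
          omega
        · omega
        · omega
      rw [Sym2.eq_iff] at hpe
      rcases hpe with ⟨rfl, rfl⟩ | ⟨rfl, rfl⟩
      · exact hadj
      · exact hadj.symm
  · intro h
    by_cases hold : u.2.val < j ∧ v.2.val < j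
    · exact Or.inl ⟨h.1, hold⟩
    · refine Or.inr ⟨h.ne, ?_⟩
      have h1 := h.2
      have hg := h.1.1
      rw [gridGraph_adj] at hg
      have hu : u.2.val + 1 = j ∨ u.2.val = j := by omega
      have hv : v.2.val + 1 = j ∨ v.2.val = j := by omega
      by_cases hdir : u.2.val = j ∧
          ((v.2.val = j ∧ u.1.val + 1 = v.1.val) ∨ (v.2.val + 1 = j ∧ u.1 = v.1))
      · exact ⟨(⟨u, h.1.2.1, hu⟩, ⟨v, h.1.2.2, hv⟩), mem_stripEdges.2 hdir, rfl⟩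
      · refine ⟨(⟨v, h.1.2.2, hv⟩, ⟨u, h.1.2.1, hu⟩), mem_stripEdges.2 ?_, Sym2.eq_swap⟩
        rw [Fin.ext_iff] at hdir ⊢
        dsimp only
        omega

theorem stripVertex_new {k n : ℕ} {A : Matrix (Fin k) (Fin n) Bool} {j : ℕ} (L : Letter k)
    {x : Strip A j} (hx : x.1.2.val = j) : stripVertex L x = Sum.inl x.1.1 := if_pos hx

theorem stripVertex_old {k n : ℕ} {A : Matrix (Fin k) (Fin n) Bool} {j : ℕ} (L : Letter k)
    {x : Strip A j} (hx : x.1.2.val + 1 = j) : stripVertex L x = Sum.inr (L.2.part x.1.1) :=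
  if_neg (by omega)

theorem Records.addEdges_bot {k n : ℕ} {A : Matrix (Fin k) (Fin n) Bool} {j : ℕ}
    {L : Letter k} (h : Records A j L) :
    addEdges ⊥ (stripVertex L) (stripEdges A j) = mergeGraph L (colOf A (j + 1)) := by
  ext u v
  rw [addEdges_adj, mergeGraph_adj]
  have hnew : ∀ x : Strip A j, x.1.2.val = j → colOf A (j + 1) x.1.1 = true := fun x hx => by
    rw [colOf_eq A x.1 (by omega)]
    exact x.2.1
  have hold : ∀ x : Strip A j, x.1.2.val + 1 = j → L.1 x.1.1 = true := fun x hx => by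
    rw [h.col, colOf_eq A x.1 hx]
    exact x.2.1
  constructor
  · rintro (h | ⟨-, p, hp, hpe⟩)
    · exact h.elim
    · rw [mem_stripEdges] at hp
      obtain ⟨h1, ⟨h2, h3⟩ | ⟨h2, h3⟩⟩ := hp
      · rw [stripVertex_new L h1, stripVertex_new L h2, Sym2.eq_iff] at hpe
        refine Or.inl ⟨p.1.1.1, p.2.1.1, h3, hnew _ h1, hnew _ h2, ?_⟩
        rcases hpe with ⟨rfl, rfl⟩ | ⟨rfl, rfl⟩
        · exact Or.inl ⟨rfl, rfl⟩
        · exact Or.inr ⟨rfl, rfl⟩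
      · rw [stripVertex_new L h1, stripVertex_old L h2, ← h3, Sym2.eq_iff] at hpe
        refine Or.inr ⟨p.1.1.1, h3 ▸ hold _ h2, hnew _ h1, ?_⟩
        rcases hpe with ⟨rfl, rfl⟩ | ⟨rfl, rfl⟩
        · exact Or.inl ⟨rfl, rfl⟩
        · exact Or.inr ⟨rfl, rfl⟩
  · rintro (⟨i, i', h1, h2, h3, hxy⟩ | ⟨i, h1, h2, hxy⟩)
    · obtain ⟨x, rfl, hxj, hx⟩ := colOf_eq_true h2
      obtain ⟨y, rfl, hyj, hy⟩ := colOf_eq_true h3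
      have hne : (Sum.inl x.1 : Fin k ⊕ Finset (Fin k)) ≠ Sum.inl y.1 := fun e => by
        rw [Sum.inl.inj e] at h1
        omega
      refine Or.inr ⟨?_, (⟨x, hx, by omega⟩, ⟨y, hy, by omega⟩), mem_stripEdges.2 ?_, ?_⟩
      · rcases hxy with ⟨rfl, rfl⟩ | ⟨rfl, rfl⟩
        · exact hne
        · exact hne.symm
      · exact ⟨by dsimp only; omega, Or.inl ⟨by dsimp only; omega, h1⟩⟩
      · rw [stripVertex_new L (by dsimp only; omega), stripVertex_new L (by dsimp only; omega),
          Sym2.eq_iff]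
        rcases hxy with ⟨rfl, rfl⟩ | ⟨rfl, rfl⟩
        · exact Or.inl ⟨rfl, rfl⟩
        · exact Or.inr ⟨rfl, rfl⟩
    · obtain ⟨x, rfl, hxj, hx⟩ := colOf_eq_true h2
      rw [h.col] at h1
      obtain ⟨y, hyx, hyj, hy⟩ := colOf_eq_true h1
      refine Or.inr ⟨?_, (⟨x, hx, by omega⟩, ⟨y, hy, by omega⟩), mem_stripEdges.2 ?_, ?_⟩
      · rcases hxy with ⟨rfl, rfl⟩ | ⟨rfl, rfl⟩
        · exact Sum.inl_ne_inr
        · exact Sum.inr_ne_inl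
      · exact ⟨by dsimp only; omega, Or.inr ⟨hyj, hyx.symm⟩⟩
      · rw [stripVertex_new L (by dsimp only; omega), stripVertex_old L hyj, Sym2.eq_iff]
        dsimp only
        rw [hyx]
        rcases hxy with ⟨rfl, rfl⟩ | ⟨rfl, rfl⟩
        · exact Or.inl ⟨rfl, rfl⟩
        · exact Or.inr ⟨rfl, rfl⟩

theorem nodup_stripEdges {k n : ℕ} (A : Matrix (Fin k) (Fin n) Bool) (j : ℕ) :
    (stripEdges A j).Nodup := Finset.nodup_toList _

theorem nodup_map_val_stripEdges {k n : ℕ} (A : Matrix (Fin k) (Fin n) Bool) (j : ℕ) :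
    ((stripEdges A j).map fun p => s(p.1.1, p.2.1)).Nodup := by
  refine (nodup_stripEdges A j).map_on fun p hp q hq hpq => ?_
  rw [mem_stripEdges] at hp hq
  rw [Sym2.eq_iff] at hpq
  rcases hpq with ⟨h1, h2⟩ | ⟨h1, h2⟩
  · exact Prod.ext (Subtype.ext h1) (Subtype.ext h2)
  · rw [h1, h2] at hp
    rw [Fin.ext_iff] at hp hq
    omega

theorem nodup_map_stripVertex_stripEdges {k n : ℕ} (A : Matrix (Fin k) (Fin n) Bool) (j : ℕ)
    (L : Letter k) :
    ((stripEdges A j).map fun p => s(stripVertex L p.1, stripVertex L p.2)).Nodup := by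
  refine (nodup_stripEdges A j).map_on fun p hp q hq hpq => ?_
  rw [mem_stripEdges] at hp hq
  have key : ∀ x y : Strip A j, x.1.2.val = y.1.2.val → x.1.1 = y.1.1 → x = y :=
    fun x y h1 h2 => Subtype.ext (Prod.ext h2 (Fin.ext h1))
  obtain ⟨hp1, ⟨hp2, hp3⟩ | ⟨hp2, hp3⟩⟩ := hp <;>
    obtain ⟨hq1, ⟨hq2, hq3⟩ | ⟨hq2, hq3⟩⟩ := hq
  · rw [stripVertex_new L hp1, stripVertex_new L hp2, stripVertex_new L hq1,
      stripVertex_new L hq2, Sym2.eq_iff] at hpq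
    rcases hpq with ⟨h1, h2⟩ | ⟨h1, h2⟩
    · exact Prod.ext (key _ _ (hp1.trans hq1.symm) (Sum.inl.inj h1))
        (key _ _ (hp2.trans hq2.symm) (Sum.inl.inj h2))
    · rw [Sum.inl.inj h1, Sum.inl.inj h2] at hp3
      omega
  · rw [stripVertex_new L hp1, stripVertex_new L hp2, stripVertex_new L hq1,
      stripVertex_old L hq2, Sym2.eq_iff] at hpq
    rcases hpq with ⟨h1, h2⟩ | ⟨h1, h2⟩
    · exact absurd h2 Sum.inl_ne_inr
    · exact absurd h1 Sum.inl_ne_inr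
  · rw [stripVertex_new L hp1, stripVertex_old L hp2, stripVertex_new L hq1,
      stripVertex_new L hq2, Sym2.eq_iff] at hpq
    rcases hpq with ⟨h1, h2⟩ | ⟨h1, h2⟩
    · exact absurd h2 Sum.inr_ne_inl
    · exact absurd h2 Sum.inr_ne_inl
  · rw [stripVertex_new L hp1, stripVertex_old L hp2, stripVertex_new L hq1,
      stripVertex_old L hq2, Sym2.eq_iff] at hpq
    rcases hpq with ⟨h1, h2⟩ | ⟨h1, h2⟩
    · have e := key _ _ (hp1.trans hq1.symm) (Sum.inl.inj h1)
      refine Prod.ext e (key _ _ (by omega) ?_)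
      rw [← hp3, ← hq3, e]
    · exact absurd h1 Sum.inl_ne_inr

/-- Adding a column closes a cycle of ones exactly when it closes a cycle after every component of
the previous columns has been contracted to one vertex. -/
theorem Records.isAcyclic_succ_iff {k n : ℕ} {A : Matrix (Fin k) (Fin n) Bool} {j : ℕ}
    {L : Letter k} (h : Records A j L) :
    (partGraph A (j + 1)).IsAcyclic ↔ (mergeGraph L (colOf A (j + 1))).IsAcyclic := by
  rw [← addEdges_partGraph, ← h.addEdges_bot,
    isAcyclic_addEdges_iff (partGraph A j) Subtype.val
      (fun x y : Strip A j => (partGraph A j).Reachable x.1 y.1) (fun _ _ => Iff.rfl),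
    isAcyclic_addEdges_iff ⊥ (stripVertex L)
      (fun x y : Strip A j => (partGraph A j).Reachable x.1 y.1)]
  · simp [h.valid.acyclic, isAcyclic_bot]
  · intro x y
    rw [h.reachable_iff_stripVertex_eq, reachable_bot]
  · intro p hp
    obtain ⟨h1, ⟨h2, h3⟩ | ⟨h2, h3⟩⟩ := mem_stripEdges.1 hp
    · rw [stripVertex_new L h1, stripVertex_new L h2]
      intro e
      rw [Sum.inl.inj e] at h3
      omega
    · rw [stripVertex_new L h1, stripVertex_old L h2]
      exact Sum.inl_ne_inr
  · exact fun p _ h => h.elim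
  · exact nodup_map_stripVertex_stripEdges A j L
  · intro p hp e
    rw [mem_stripEdges, e] at hp
    omega
  · intro p hp hadj
    have := hadj.2.1
    have := (mem_stripEdges.1 hp).1
    omega
  · exact nodup_map_val_stripEdges A j

theorem Records.reachable_succ_iff {k n : ℕ} {A : Matrix (Fin k) (Fin n) Bool} {j : ℕ}
    {L : Letter k} (h : Records A j L) (x y : Strip A j) :
    (partGraph A (j + 1)).Reachable x.1 y.1 ↔
      (mergeGraph L (colOf A (j + 1))).Reachable (stripVertex L x) (stripVertex L y) := by
  rw [← addEdges_partGraph, ← h.addEdges_bot,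
    ← joinList_iff_reachable (partGraph A j) Subtype.val
      (fun x y : Strip A j => (partGraph A j).Reachable x.1 y.1) (fun _ _ => Iff.rfl),
    ← joinList_iff_reachable ⊥ (stripVertex L)
      (fun x y : Strip A j => (partGraph A j).Reachable x.1 y.1)]
  intro x y
  rw [h.reachable_iff_stripVertex_eq, reachable_bot]

/-- The followers of a letter are exactly the records of one more column. -/
theorem Records.succ_iff_follows {k n : ℕ} {A : Matrix (Fin k) (Fin n) Bool} {j : ℕ}
    {L L' : Letter k} (h : Records A j L) (hL' : L'.1 = colOf A (j + 1)) :
    Records A (j + 1) L' ↔ Follows L L' := by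
  -- connections between the ones of the new column
  have hnew : ∀ x y : Fin k × Fin n, A x.1 x.2 = true → A y.1 y.2 = true → x.2.val = j →
      y.2.val = j → ((partGraph A (j + 1)).Reachable x y ↔
        (mergeGraph L L'.1).Reachable (Sum.inl x.1) (Sum.inl y.1)) := by
    intro x y hx hy hxj hyj
    have := h.reachable_succ_iff ⟨x, hx, Or.inr hxj⟩ ⟨y, hy, Or.inr hyj⟩
    rw [stripVertex_new L hxj, stripVertex_new L hyj] at this
    rw [this, hL']
  constructor
  · intro h'
    refine ⟨fun a ha => ?_, ?_, ?_, ?_⟩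
    · rw [h.col, hL']
      exact h'.valid.window a j ha (by omega)
    · rw [hL', ← h.isAcyclic_succ_iff]
      exact h'.valid.acyclic
    · intro B hB
      obtain ⟨i, hi⟩ := L.2.nonempty_of_mem_parts hB
      have hLi := Letter.eq_true_of_mem hB hi
      rw [h.col] at hLi
      obtain ⟨x, rfl, hxj, hx⟩ := colOf_eq_true hLi
      obtain ⟨y, hy, hyj, hxy⟩ := h'.valid.reach x hx (by omega)
      obtain ⟨z, z', hz, hz', hzz', hzj, hz'j, hxz⟩ := exists_exit hxy (by omega) (by omega)
      refine ⟨z.1, ?_, ?_⟩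
      · obtain ⟨C, hC, h1, h2⟩ := (h.block x z hx hz hxj hzj).2 hxz
        rwa [Letter.eq_part hB hi, ← Letter.eq_part hC h1]
      · rw [hL', hzz', colOf_eq A z' (by omega)]
        exact hz'
    · intro i i' hi hi'
      rw [hL'] at hi hi'
      obtain ⟨x, rfl, hxj, hx⟩ := colOf_eq_true hi
      obtain ⟨y, rfl, hyj, hy⟩ := colOf_eq_true hi'
      rw [← hnew x y hx hy (by omega) (by omega)]
      exact h'.block x y hx hy hxj hyj
  · rintro ⟨h1, h2, h3, h4⟩
    refine ⟨⟨?_, ?_, ?_⟩, hL', ?_⟩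
    · intro a b ha hb
      rcases Nat.lt_succ_iff_lt_or_eq.1 hb with hb | rfl
      · exact h.valid.window a b ha hb
      · have := h1 a ha
        rw [h.col, hL'] at this
        exact this
    · rw [h.isAcyclic_succ_iff, ← hL']
      exact h2
    · intro x hx hxj
      rcases Nat.lt_succ_iff_lt_or_eq.1 hxj with hxj | hxj
      · obtain ⟨y, hy, hyj, hxy⟩ := h.valid.reach x hx hxj
        have hLy : L.1 y.1 = true := by rw [h.col, colOf_eq A y hyj, hy]
        obtain ⟨i, hi, hLi⟩ := h3 _ (L.part_mem hLy)
        have hLi' := Letter.eq_true_of_mem (L.part_mem hLy) hi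
        rw [h.col] at hLi'
        rw [hL'] at hLi
        obtain ⟨z, rfl, hzj, hz⟩ := colOf_eq_true hLi'
        obtain ⟨z', hzz', hz'j, hz'⟩ := colOf_eq_true hLi
        have hyz := (h.block y z hy hz hyj hzj).1 ⟨_, L.part_mem hLy, L.mem_part hLy, hi⟩
        have hadj : (partGraph A (j + 1)).Adj z z' := by
          refine ⟨⟨?_, hz, hz'⟩, by omega, by omega⟩
          rw [gridGraph_adj]
          rw [Fin.ext_iff] at hzz'
          omega
        exact ⟨z', hz', hz'j, ((hxy.trans hyz).mono (partGraph_mono A j)).trans hadj.reachable⟩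
      · exact ⟨x, hx, by omega, Reachable.refl _⟩
    · intro x y hx hy hxj hyj
      rw [hnew x y hx hy (by omega) (by omega)]
      exact h4 x.1 y.1 (by rw [hL', colOf_eq A x hxj, hx]) (by rw [hL', colOf_eq A y hyj, hy])

/-! ### The empty letter and the starters -/

/-- The letter with no ones, standing for the zero column before the matrix. -/
def zeroLetter (k : ℕ) : Letter k := ⟨fun _ => false, ⊥⟩

theorem mergeGraph_zeroLetter_adj {k : ℕ} (v : Fin k → Bool) (x y : Fin k ⊕ Finset (Fin k)) :
    (mergeGraph (zeroLetter k) v).Adj x y ↔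
      ∃ i j : Fin k, i.val + 1 = j.val ∧ v i = true ∧ v j = true ∧
        ((x = Sum.inl i ∧ y = Sum.inl j) ∨ (x = Sum.inl j ∧ y = Sum.inl i)) := by
  rw [mergeGraph_adj]
  refine or_iff_left ?_
  rintro ⟨i, h, -⟩
  exact absurd h (by simp [zeroLetter])

/-- Without preceding blocks, the connected ones of a column are those in the same run. -/
theorem reachable_mergeGraph_zeroLetter {k : ℕ} (v : Fin k → Bool) {i j : Fin k} (hij : i ≤ j)
    (hi : v i = true) :
    (mergeGraph (zeroLetter k) v).Reachable (Sum.inl i) (Sum.inl j) ↔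
      ∀ l : Fin k, i ≤ l → l ≤ j → v l = true := by
  constructor
  · intro h
    rw [reachable_iff_reflTransGen] at h
    have key : ∀ x, Relation.ReflTransGen (mergeGraph (zeroLetter k) v).Adj (Sum.inl i) x →
        ∃ b : Fin k, x = Sum.inl b ∧ ∀ l : Fin k, i ≤ l → l ≤ b → v l = true := by
      intro x h
      induction h with
      | refl => exact ⟨i, rfl, fun l h1 h2 => le_antisymm h2 h1 ▸ hi⟩
      | tail _ hadj ih =>
        obtain ⟨b, rfl, hb⟩ := ih
        obtain ⟨c, d, hcd, hc, hd, ⟨h1, rfl⟩ | ⟨h1, rfl⟩⟩ :=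
          (mergeGraph_zeroLetter_adj v _ _).1 hadj
        · obtain rfl := Sum.inl.inj h1
          refine ⟨d, rfl, fun l h1 h2 => ?_⟩
          rcases h2.eq_or_lt with rfl | h2
          · exact hd
          · exact hb l h1 (Fin.le_def.2 (by rw [Fin.lt_def] at h2; omega))
        · obtain rfl := Sum.inl.inj h1
          exact ⟨c, rfl, fun l h1 h2 => hb l h1 (Fin.le_def.2 (by rw [Fin.le_def] at h2; omega))⟩
    obtain ⟨b, hb, hb'⟩ := key _ h
    obtain rfl := Sum.inl.inj hb
    exact hb'
  · intro h
    obtain ⟨d, hd⟩ := Nat.exists_eq_add_of_le (Fin.le_def.1 hij)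
    induction d generalizing j with
    | zero =>
      rw [show j = i from Fin.ext hd]
    | succ d ih =>
      have hlt : i.val + d < k := by omega
      refine (ih (j := ⟨i.val + d, hlt⟩) (Fin.le_def.2 (Nat.le_add_right _ _))
        (fun l h1 h2 => h l h1 (Fin.le_def.2 (by rw [Fin.le_def] at h2; dsimp only at h2; omega)))
        rfl).trans (Adj.reachable ?_)
      rw [mergeGraph_zeroLetter_adj]
      exact ⟨⟨i.val + d, hlt⟩, j, by dsimp only; omega,
        h _ (Fin.le_def.2 (Nat.le_add_right _ _)) (Fin.le_def.2 (by dsimp only; omega)),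
        h j hij le_rfl, Or.inl ⟨rfl, rfl⟩⟩

theorem isAcyclic_mergeGraph_zeroLetter {k : ℕ} (v : Fin k → Bool) :
    (mergeGraph (zeroLetter k) v).IsAcyclic := by
  rw [isAcyclic_iff_forall_adj_isBridge]
  -- deleting the edge between the rows `i` and `i + 1` separates the rows up to `i` from the rest
  have key : ∀ i j : Fin k, i.val + 1 = j.val →
      (mergeGraph (zeroLetter k) v).IsBridge s(Sum.inl i, Sum.inl j) := by
    intro i j hij
    rw [isBridge_iff]
    intro h
    rw [reachable_iff_reflTransGen] at h
    have key : ∀ x, Relation.ReflTransGen ((mergeGraph (zeroLetter k) v).deleteEdges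
        {s(Sum.inl i, Sum.inl j)}).Adj (Sum.inl i) x → ∃ b : Fin k, x = Sum.inl b ∧ b ≤ i := by
      intro x h
      induction h with
      | refl => exact ⟨i, rfl, le_rfl⟩
      | tail _ hadj ih =>
        obtain ⟨b, rfl, hb⟩ := ih
        rw [deleteEdges_adj, mergeGraph_zeroLetter_adj] at hadj
        obtain ⟨⟨c, d, hcd, -, -, ⟨h1, rfl⟩ | ⟨h1, rfl⟩⟩, hne⟩ := hadj
        · obtain rfl := Sum.inl.inj h1
          refine ⟨d, rfl, Fin.le_def.2 ?_⟩
          by_contra hlt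
          rw [Fin.le_def] at hb
          refine hne ?_
          rw [show b = i from Fin.ext (by omega), show d = j from Fin.ext (by omega)]
          rfl
        · obtain rfl := Sum.inl.inj h1
          exact ⟨c, rfl, Fin.le_def.2 (by rw [Fin.le_def] at hb; omega)⟩
    obtain ⟨b, hb, hbi⟩ := key _ h
    obtain rfl := Sum.inl.inj hb
    rw [Fin.le_def] at hbi
    omega
  intro x y hxy
  obtain ⟨i, j, hij, -, -, ⟨rfl, rfl⟩ | ⟨rfl, rfl⟩⟩ := (mergeGraph_zeroLetter_adj v x y).1 hxy
  · exact key i j hij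
  · rw [Sym2.eq_swap]
    exact key i j hij

theorem isStarter_iff_follows {k : ℕ} (L : Letter k) :
    IsStarter L ↔ Follows (zeroLetter k) L := by
  have hzero : ∀ a, padCol (zeroLetter k).1 a = false := fun a => by simp [zeroLetter, padCol]
  rw [IsStarter, Follows]
  simp only [hzero]
  refine and_congr_right fun _ => ?_
  constructor
  · intro h
    refine ⟨isAcyclic_mergeGraph_zeroLetter L.1, ?_, ?_⟩
    · intro B hB
      obtain ⟨i, hi⟩ := (zeroLetter k).2.nonempty_of_mem_parts hB
      exact absurd (Letter.eq_true_of_mem hB hi) (by simp [zeroLetter])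
    · intro i j hi hj
      rcases le_total i j with hij | hij
      · rw [h i j hij, reachable_mergeGraph_zeroLetter L.1 hij hi]
      · rw [reachable_comm, reachable_mergeGraph_zeroLetter L.1 hij hj, ← h j i hij]
        exact ⟨SameBlock.symm, SameBlock.symm⟩
  · rintro ⟨-, -, h⟩ i j hij
    by_cases hb : L.1 i = true ∧ L.1 j = true
    · rw [h i j hb.1 hb.2, reachable_mergeGraph_zeroLetter L.1 hij hb.1]
    · refine iff_of_false (fun h' => hb (SameBlock.eq_true h')) fun h' => hb ?_
      exact ⟨h' i le_rfl hij, h' j hij le_rfl⟩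

/-! ### Words accepted by the transfer automaton -/

/-- The word of columns `w` can follow the letter `L`, up to the end of a matrix. -/
def Accepts {k : ℕ} : (r : ℕ) → Letter k → (Fin r → Fin k → Bool) → Prop
  | 0, L, _ => IsEnder L
  | r + 1, L, w => ∃ L' : Letter k, L'.1 = w 0 ∧ Follows L L' ∧ Accepts r L' (Fin.tail w)

theorem IsGoodMatrix.validPrefix {k n : ℕ} {A : Matrix (Fin k) (Fin n) Bool}
    (h : IsGoodMatrix A) {j : ℕ} (hj : j ≤ n) : ValidPrefix A j := by
  obtain ⟨h1, h2, -, h4⟩ := (isGoodMatrix_iff A).1 h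
  have hlast : ValidPrefix A n := by
    refine ⟨fun a b ha hb => h1 a b ha hb.le, by rwa [partGraph_self], fun x hx _ => ?_⟩
    -- the window at the upper right corner of the grid forces a one into the last column
    have hw := (h1 0 n (Nat.zero_le _) le_rfl).1
    rw [pad_eq_false A (by omega), pad_eq_false A (by omega),
      pad_eq_false A (a := 0 + 1) (b := n + 1) (by omega)] at hw
    obtain ⟨y, -, hyn, hy⟩ := pad_eq_true (A := A) (a := 0 + 1) (b := n)
      (Bool.eq_true_of_not_eq_false fun e => hw ⟨rfl, e.symm, e⟩)
    exact ⟨y, hy, hyn, by rw [partGraph_self]; exact h4 x y hx hy⟩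
  exact Nat.decreasingInduction (motive := fun j _ => ValidPrefix A j)
    (fun _ _ h => h.pred) hlast hj

/-- After the last column, the matrix is good exactly when the letter is an ender. -/
theorem Records.isEnder_iff {k n : ℕ} {A : Matrix (Fin k) (Fin n) Bool} {L : Letter k}
    (h : Records A n L) : IsEnder L ↔ IsGoodMatrix A := by
  have hwin : (∀ a ≤ k, Window (padCol L.1 a) false (padCol L.1 (a + 1)) false) ↔
      ∀ a ≤ k, Window (pad A a n) (pad A a (n + 1)) (pad A (a + 1) n) (pad A (a + 1) (n + 1)) := by
    refine forall₂_congr fun a _ => ?_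
    rw [h.col, pad_eq_false A (a := a) (b := n + 1) (by omega),
      pad_eq_false A (a := a + 1) (b := n + 1) (by omega)]
    rfl
  have hL : ∀ x : Fin k × Fin n, x.2.val + 1 = n → A x.1 x.2 = true → L.1 x.1 = true :=
    fun x hxj hx => by rw [h.col, colOf_eq A x hxj, hx]
  have hacyc := h.valid.acyclic
  have hreach := h.valid.reach
  have hblock := h.block
  rw [partGraph_self] at hacyc hreach hblock
  rw [isGoodMatrix_iff, IsEnder, hwin, Finset.card_eq_one]
  constructor
  · rintro ⟨h1, B, hB⟩
    have hBm : B ∈ L.2.parts := by simp [hB]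
    refine ⟨?_, hacyc, ?_, ?_⟩
    · intro a b ha hb
      rcases hb.lt_or_eq with hb | rfl
      · exact h.valid.window a b ha hb
      · exact h1 a ha
    · obtain ⟨i, hi⟩ := L.2.nonempty_of_mem_parts hBm
      have := Letter.eq_true_of_mem hBm hi
      rw [h.col] at this
      obtain ⟨x, -, -, hx⟩ := colOf_eq_true this
      exact ⟨x, hx⟩
    · have hmem : ∀ x : Fin k × Fin n, x.2.val + 1 = n → A x.1 x.2 = true → x.1 ∈ B := by
        intro x hxj hx
        have := L.part_mem (hL x hxj hx)
        rw [hB, Finset.mem_singleton] at this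
        exact this ▸ L.mem_part (hL x hxj hx)
      intro x y hx hy
      obtain ⟨x', hx', hxj, hxx'⟩ := hreach x hx x.2.2
      obtain ⟨y', hy', hyj, hyy'⟩ := hreach y hy y.2.2
      have := (hblock x' y' hx' hy' hxj hyj).1 ⟨B, hBm, hmem x' hxj hx', hmem y' hyj hy'⟩
      exact (hxx'.trans this).trans hyy'.symm
  · rintro ⟨h1, -, ⟨x, hx⟩, h2⟩
    refine ⟨fun a ha => h1 a n ha le_rfl, ?_⟩
    obtain ⟨x', hx', hxj, -⟩ := hreach x hx x.2.2
    refine ⟨L.2.part x'.1, Finset.eq_singleton_iff_unique_mem.2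
      ⟨L.part_mem (hL x' hxj hx'), fun C hC => ?_⟩⟩
    obtain ⟨i, hi⟩ := L.2.nonempty_of_mem_parts hC
    have hLi := Letter.eq_true_of_mem hC hi
    have hLi' := hLi
    rw [h.col] at hLi'
    obtain ⟨y, rfl, hyj, hy⟩ := colOf_eq_true hLi'
    rw [Letter.eq_part hC hi, ← sameBlock_iff_part_eq L hLi (hL x' hxj hx')]
    exact (hblock y x' hy hx' hyj hxj).2 (h2 y x' hy hx')

theorem Records.accepts_iff {k n : ℕ} {A : Matrix (Fin k) (Fin n) Bool} (r : ℕ) {j : ℕ}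
    {L : Letter k} (h : Records A j L) (hjr : j + r = n) (w : Fin r → Fin k → Bool)
    (hw : ∀ i : Fin r, w i = colOf A (j + i.val + 1)) :
    Accepts r L w ↔ IsGoodMatrix A := by
  induction r generalizing j L with
  | zero =>
    obtain rfl : j = n := hjr
    exact h.isEnder_iff
  | succ r ih =>
    have hw0 : w 0 = colOf A (j + 1) := hw 0
    have htail : ∀ i : Fin r, Fin.tail w i = colOf A (j + 1 + i.val + 1) := fun i => by
      rw [Fin.tail, hw i.succ, Fin.val_succ]
      congr 1
      omega
    constructor
    · rintro ⟨L', hL', hfol, hacc⟩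
      exact (ih ((h.succ_iff_follows (hL'.trans hw0)).2 hfol) (by omega) _ htail).1 hacc
    · intro hA
      obtain ⟨L', hL'⟩ := (hA.validPrefix (j := j + 1) (by omega)).exists_records
      exact ⟨L', hL'.col.trans hw0.symm, (h.succ_iff_follows hL'.col).1 hL',
        (ih hL' (by omega) _ htail).2 hA⟩

theorem records_zero {k n : ℕ} (A : Matrix (Fin k) (Fin n) Bool) :
    Records A 0 (zeroLetter k) where
  valid := {
    window := fun a b _ hb => absurd hb (Nat.not_lt_zero b)
    acyclic := by
      have : partGraph A 0 = ⊥ := by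
        ext x y
        exact ⟨fun h => absurd h.2.1 (Nat.not_lt_zero _), fun h => h.elim⟩
      rw [this]
      exact isAcyclic_bot
    reach := fun x _ hx => absurd hx (Nat.not_lt_zero _) }
  col := by
    funext i
    exact (padCol_eq_false (A i) 0 (by omega)).symm
  block x y _ _ hx _ := absurd hx (Nat.succ_ne_zero _)

/-- The good matrices are the transposes of the words accepted from the empty letter. -/
theorem accepts_zeroLetter_iff {k n : ℕ} (A : Matrix (Fin k) (Fin n) Bool) :
    Accepts n (zeroLetter k) A.transpose ↔ IsGoodMatrix A := by
  refine (records_zero A).accepts_iff n (by omega) _ fun i => ?_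
  funext a
  rw [zero_add]
  exact (colOf_eq A (a, i) rfl).symm

open Classical in
/-- The number of words of length `r` that can follow the letter `L`. -/
noncomputable def pathCount {k : ℕ} : ℕ → Letter k → ℕ
  | 0, L => if IsEnder L then 1 else 0
  | r + 1, L => ∑ L' : Letter k, if Follows L L' then pathCount r L' else 0

theorem ncard_accepts {k : ℕ} (r : ℕ) (L : Letter k) :
    {w | Accepts r L w}.ncard = pathCount r L := by
  classical
  have hcard : ∀ (r : ℕ) (L : Letter k), {w | Accepts r L w}.ncard =
      (Finset.univ.filter fun w => Accepts r L w).card := fun r L => by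
    rw [← Set.ncard_coe_finset, Finset.coe_filter_univ]
  rw [hcard]
  induction r generalizing L with
  | zero =>
    by_cases h : IsEnder L <;> simp [Accepts, pathCount, h]
  | succ r ih =>
    have hunion : (Finset.univ.filter fun w => Accepts (r + 1) L w) =
        (Finset.univ.filter fun L' => Follows L L').biUnion fun L' : Letter k =>
          (Finset.univ.filter fun w => Accepts r L' w).image
            fun w : Fin r → Fin k → Bool => (Fin.cons L'.1 w : Fin (r + 1) → Fin k → Bool) := by
      ext w
      simp only [Finset.mem_biUnion, Finset.mem_filter, Finset.mem_univ, true_and,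
        Finset.mem_image]
      constructor
      · rintro ⟨L', h1, h2, h3⟩
        exact ⟨L', h2, Fin.tail w, h3, by rw [h1, Fin.cons_self_tail]⟩
      · rintro ⟨L', h2, w', h3, rfl⟩
        exact ⟨L', by rw [Fin.cons_zero], h2, by rwa [Fin.tail_cons]⟩
    rw [hunion, Finset.card_biUnion, pathCount, ← Finset.sum_filter]
    · refine Finset.sum_congr rfl fun L' _ => ?_
      rw [← ih, Finset.card_image_of_injective _ (Fin.cons_right_injective (α := fun _ => _) L'.1)]
    · intro L₁ h₁ L₂ h₂ hne
      rw [Function.onFun, Finset.disjoint_left]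
      intro w hw₁ hw₂
      obtain ⟨w₁, -, rfl⟩ := Finset.mem_image.1 hw₁
      obtain ⟨w₂, -, h⟩ := Finset.mem_image.1 hw₂
      refine hne (Follows.unique (Finset.mem_filter.1 h₁).2 (Finset.mem_filter.1 h₂).2 ?_)
      have := congrFun h 0
      rwa [Fin.cons_zero, Fin.cons_zero, eq_comm] at this

theorem numHamCycles_eq_pathCount (k n : ℕ) :
    numHamCycles (k + 1) (n + 1) = pathCount n (zeroLetter k) := by
  rw [numHamCycles, ← ncard_accepts, ← (bijOn_boundaryEdges k n).image_eq,
    Set.ncard_image_of_injective _ boundaryEdges_injective,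
    ← Set.ncard_image_of_injective _ (Matrix.transpose_injective)]
  congr 1
  ext w
  constructor
  · rintro ⟨A, hA, rfl⟩
    exact (accepts_zeroLetter_iff A).2 hA
  · intro h
    exact ⟨Matrix.transpose w, (accepts_zeroLetter_iff (Matrix.transpose w)).1 h, rfl⟩

/-! ### The transfer matrix -/

theorem SSMatrix_apply {k : ℕ} (x y : SSVertex k) [Decidable (SSEdge x y)] :
    SSMatrix k x y = if SSEdge x y then 1 else 0 := by
  rw [SSMatrix, Matrix.of_apply]
  congr

/-- The determinant is a polynomial with constant term one. -/
theorem det_one_sub_X_smul_SSMatrix_ne_zero (k : ℕ) :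
    (1 - (RatFunc.X : RatFunc ℚ) • SSMatrix k).det ≠ 0 := by
  classical
  let N : Matrix (SSVertex k) (SSVertex k) ℚ := Matrix.of fun x y => if SSEdge x y then 1 else 0
  have h : 1 - (RatFunc.X : RatFunc ℚ) • SSMatrix k =
      (1 - (Polynomial.X : Polynomial ℚ) • N.map Polynomial.C).map
        (algebraMap (Polynomial ℚ) (RatFunc ℚ)) := by
    ext x y
    rw [Matrix.map_apply, Matrix.sub_apply, Matrix.sub_apply, Matrix.smul_apply,
      Matrix.smul_apply, Matrix.map_apply, show N x y = if SSEdge x y then 1 else 0 from rfl,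
      SSMatrix_apply, map_sub, smul_eq_mul, smul_eq_mul, map_mul, RatFunc.algebraMap_X]
    congr 1
    · rw [Matrix.one_apply, Matrix.one_apply]
      split_ifs <;> simp
    · split_ifs <;> simp
  rw [h, ← RingHom.mapMatrix_apply, ← RingHom.map_det]
  change algebraMap (Polynomial ℚ) (RatFunc ℚ) N.charpolyRev ≠ 0
  rw [ne_eq, map_eq_zero_iff _ (RatFunc.algebraMap_injective ℚ)]
  intro h0
  have := N.eval_charpolyRev
  rw [h0] at this
  simp at this

/-- Solutions of a regular linear system in an extension are given by the inverse matrix. -/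
theorem eq_map_inv_of_mulVec_eq {n F K : Type*} [Fintype n] [DecidableEq n] [Field F] [CommRing K]
    (φ : F →+* K) {A : Matrix n n F} (hA : A.det ≠ 0) (x : n → K) (j : n)
    (hx : (A.map φ).mulVec x = Pi.single j 1) (i : n) : φ (A⁻¹ i j) = x i := by
  have h1 : A⁻¹.map φ * A.map φ = 1 := by
    rw [← Matrix.map_mul, Matrix.nonsing_inv_mul A (isUnit_iff_ne_zero.2 hA)]
    simp
  have h2 : x = (A⁻¹.map φ).mulVec (Pi.single j 1) := by
    rw [← hx, Matrix.mulVec_mulVec, h1, Matrix.one_mulVec]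
  rw [h2, Matrix.mulVec_single_one]
  rfl

open Classical in
/-- All the followers of a letter of the alphabet belong to the alphabet, as do all the starters. -/
theorem sum_alphabet_follows {k : ℕ} {K : Type*} [AddCommMonoid K] (L : Letter k)
    (hL : L = zeroLetter k ∨ ∃ S, IsStarter S ∧ Relation.ReflTransGen Follows S L)
    (x : Letter k → K) :
    ∑ L' : Alphabet k, (if Follows L L'.1 then x L'.1 else 0) =
      ∑ L' : Letter k, if Follows L L' then x L' else 0 := by
  refine Fintype.sum_of_injective (ι := Alphabet k) (κ := Letter k) (fun L => L.1)
    (fun _ _ h => Subtype.ext h) _ _ (fun L' hL' => ?_) fun _ => rfl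
  refine if_neg fun h => hL' ?_
  rcases hL with rfl | ⟨S, hS, hSL⟩
  · exact ⟨⟨L', L', (isStarter_iff_follows L').2 h, Relation.ReflTransGen.refl⟩, rfl⟩
  · exact ⟨⟨L', S, hS, hSL.tail h⟩, rfl⟩

open Classical in
/-- The generating function is obtained by solving, in any extension of `ℚ(z)`, the linear system
with one unknown for each letter. -/
theorem map_GFnz {k : ℕ} {K : Type*} [CommRing K] (φ : RatFunc ℚ →+* K) (x : Letter k → K)
    (hx : ∀ L, (∃ S, IsStarter S ∧ Relation.ReflTransGen Follows S L) →
      x L = φ RatFunc.X *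
        ((if IsEnder L then 1 else 0) + ∑ L' : Letter k, if Follows L L' then x L' else 0)) :
    φ (GFnz (k + 1)) =
      φ RatFunc.X * ∑ L' : Letter k, if Follows (zeroLetter k) L' then x L' else 0 := by
  let y : SSVertex k → K := Sum.elim
    (fun _ => φ RatFunc.X * ∑ L' : Letter k, if Follows (zeroLetter k) L' then x L' else 0)
    (Sum.elim (fun L => x L.1) fun _ => 1)
  refine eq_map_inv_of_mulVec_eq φ (det_one_sub_X_smul_SSMatrix_ne_zero k) y (endVertex k) ?_
    (startVertex k)
  have hmap : (1 - (RatFunc.X : RatFunc ℚ) • SSMatrix k).map φ =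
      1 - φ RatFunc.X • (SSMatrix k).map φ := by
    ext s t
    simp only [Matrix.map_apply, Matrix.sub_apply, Matrix.smul_apply, smul_eq_mul, map_sub,
      map_mul, Matrix.one_apply]
    split_ifs <;> simp
  have hrow : ∀ s, ((SSMatrix k).map φ).mulVec y s = ∑ t, if SSEdge s t then y t else 0 := by
    intro s
    rw [Matrix.mulVec, dotProduct]
    refine Finset.sum_congr rfl fun t _ => ?_
    rw [Matrix.map_apply, SSMatrix_apply]
    split_ifs <;> simp
  rw [hmap, Matrix.sub_mulVec, Matrix.one_mulVec, Matrix.smul_mulVec]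
  funext s
  rw [Pi.sub_apply, Pi.smul_apply, hrow, smul_eq_mul, Fintype.sum_sum_type, Fintype.sum_sum_type]
  rcases s with s | L | s
  · have h : ∑ L' : Alphabet k, (if SSEdge (Sum.inl s) (Sum.inr (Sum.inl L')) then
        y (Sum.inr (Sum.inl L')) else 0) = _ :=
      (Finset.sum_congr rfl fun L' _ => if_congr (isStarter_iff_follows L'.1) rfl rfl).trans
        (sum_alphabet_follows (zeroLetter k) (Or.inl rfl) x)
    rw [h]
    simp [SSEdge, y]
  · have h : ∑ L' : Alphabet k, (if SSEdge (Sum.inr (Sum.inl L)) (Sum.inr (Sum.inl L')) then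
        y (Sum.inr (Sum.inl L')) else 0) = _ :=
      (Finset.sum_congr rfl fun L' _ => if_congr Iff.rfl rfl rfl).trans
        (sum_alphabet_follows L.1 (Or.inr L.2) x)
    have hyL : y (Sum.inr (Sum.inl L)) = x L.1 := rfl
    have h0 : ∑ t : Unit, (if SSEdge (Sum.inr (Sum.inl L)) (Sum.inl t) then
        y (Sum.inl t) else 0) = 0 := Finset.sum_eq_zero fun t _ => if_neg id
    have h1 : ∑ t : Unit, (if SSEdge (Sum.inr (Sum.inl L)) (Sum.inr (Sum.inr t)) then
        y (Sum.inr (Sum.inr t)) else 0) = if IsEnder L.1 then 1 else 0 := by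
      rw [Finset.univ_unique, Finset.sum_singleton]
      exact if_congr Iff.rfl rfl rfl
    have h2 : (Pi.single (endVertex k) 1 : SSVertex k → K) (Sum.inr (Sum.inl L)) = 0 := by
      simp
    rw [h, h0, h1, h2, hyL, hx L.1 L.2]
    ring
  · simp [SSEdge, y]

open scoped RatFunc in
/-- The expansion of rational functions at zero, as a ring homomorphism. -/
noncomputable def expansion (F : Type*) [Field F] : RatFunc F →+* LaurentSeries F :=
  algebraMap _ _

theorem expansion_X (F : Type*) [Field F] :
    expansion F RatFunc.X = HahnSeries.ofPowerSeries ℤ F PowerSeries.X := by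
  rw [HahnSeries.ofPowerSeries_X]
  exact RatFunc.coe_X (F := F)

theorem numHamCycles_zero (m : ℕ) : numHamCycles m 0 = 0 := by
  have : hamiltonianCycles (gridGraph m 0) = ∅ := by
    rw [Set.eq_empty_iff_forall_notMem]
    rintro E ⟨a, -⟩
    exact a.2.elim0
  rw [numHamCycles, this, Set.ncard_empty]

theorem not_isEnder_zeroLetter (k : ℕ) : ¬ IsEnder (zeroLetter k) := by
  rintro ⟨-, h⟩
  obtain ⟨B, hB⟩ := Finset.card_eq_one.1 h
  have hBm : B ∈ (zeroLetter k).2.parts := by simp [hB]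
  obtain ⟨i, hi⟩ := (zeroLetter k).2.nonempty_of_mem_parts hBm
  exact absurd (Letter.eq_true_of_mem hBm hi) (by simp [zeroLetter])

open Classical in
/-- The generating function expands to the numbers of Hamiltonian cycles: the series counting the
words accepted from each letter solve the linear system. -/
theorem coe_GFnz (k : ℕ) :
    ((GFnz (k + 1) : RatFunc ℚ) : LaurentSeries ℚ) =
      ((PowerSeries.mk fun n : ℕ => (numHamCycles (k + 1) n : ℚ) : PowerSeries ℚ) :
        LaurentSeries ℚ) := by
  let F : Letter k → PowerSeries ℚ := fun L =>
    PowerSeries.X * PowerSeries.mk fun n => (pathCount n L : ℚ)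
  let ι : PowerSeries ℚ →+* LaurentSeries ℚ := HahnSeries.ofPowerSeries ℤ ℚ
  have hX : expansion ℚ RatFunc.X = ι PowerSeries.X := expansion_X ℚ
  have hsum : ∀ L : Letter k, ι (∑ L' : Letter k, if Follows L L' then F L' else 0) =
      ∑ L' : Letter k, if Follows L L' then ι (F L') else 0 := by
    intro L
    rw [map_sum]
    refine Finset.sum_congr rfl fun L' _ => ?_
    split_ifs <;> simp
  have hstep : ∀ (L : Letter k) (n : ℕ),
      PowerSeries.coeff n (∑ L' : Letter k, if Follows L L' then F L' else 0) =
        if n = 0 then 0 else (pathCount n L : ℚ) := by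
    intro L n
    rw [map_sum]
    cases n with
    | zero =>
      refine Finset.sum_eq_zero fun L' _ => ?_
      split_ifs <;> simp [F]
    | succ n =>
      rw [if_neg (Nat.succ_ne_zero n), pathCount, Nat.cast_sum]
      refine Finset.sum_congr rfl fun L' _ => ?_
      split_ifs
      · rw [PowerSeries.coeff_succ_X_mul, PowerSeries.coeff_mk]
      · simp
  have h := map_GFnz (expansion ℚ) (fun L => ι (F L)) (by
    intro L _
    rw [hX, ← hsum, show (if IsEnder L then (1 : LaurentSeries ℚ) else 0) =
      ι (if IsEnder L then 1 else 0) by split_ifs <;> simp, ← map_add, ← map_mul]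
    congr 1
    refine congrArg (PowerSeries.X * ·) ?_
    ext n
    rw [map_add, hstep, PowerSeries.coeff_mk]
    cases n with
    | zero =>
      rw [if_pos rfl, pathCount]
      split_ifs <;> simp
    | succ n =>
      rw [if_neg (Nat.succ_ne_zero n)]
      split_ifs <;> simp [PowerSeries.coeff_one])
  change expansion ℚ (GFnz (k + 1)) = _
  refine h.trans ?_
  rw [hX, ← hsum, ← map_mul]
  congr 1
  ext n
  rw [PowerSeries.coeff_mk]
  rcases n with _ | n
  · rw [PowerSeries.coeff_zero_X_mul, numHamCycles_zero, Nat.cast_zero]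
  · rw [PowerSeries.coeff_succ_X_mul, hstep, numHamCycles_eq_pathCount]
    rcases n with _ | n
    · simp [pathCount, not_isEnder_zeroLetter]
    · simp

/-! ### Computing the followers of a letter -/

/-- The pairs of a list are joined one after the other, the classes being recorded by labels; the
result is `none` if some pair has equal labels when its turn comes. -/
def joinLabels {ι : Type*} : (ι → ℕ) → List (ι × ι) → Option (ι → ℕ)
  | f, [] => some f
  | f, p :: F =>
    if f p.1 = f p.2 then none
    else joinLabels (fun z => if f z = f p.2 then f p.1 else f z) F

theorem joinLabels_spec {ι : Type*} (f : ι → ℕ) (r : ι → ι → Prop) (hr : ∀ a b, r a b ↔ f a = f b)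
    (F : List (ι × ι)) :
    (JoinsDistinct r F ↔ (joinLabels f F).isSome) ∧
      ∀ f', joinLabels f F = some f' → ∀ a b, joinList r F a b ↔ f' a = f' b := by
  induction F generalizing f r with
  | nil =>
    refine ⟨by simp [JoinsDistinct, joinLabels], fun f' hf' => ?_⟩
    obtain rfl := Option.some.inj hf'
    exact hr
  | cons p F ih =>
    rw [joinLabels, JoinsDistinct, hr]
    by_cases h : f p.1 = f p.2
    · simp [h]
    · rw [if_neg h]
      have := ih (fun z => if f z = f p.2 then f p.1 else f z) (joinRel r p.1 p.2) fun a b => by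
        simp only [joinRel, hr]
        split_ifs <;> grind
      exact ⟨(and_iff_right h).trans this.1, this.2⟩

/-- The labelling `c` describes the letter `L`: zeros are labelled `0`, and two ones have the same
label when they are in the same block. -/
def Labels {k : ℕ} (c : Fin k → ℕ) (L : Letter k) : Prop :=
  (∀ i, L.1 i = decide (c i ≠ 0)) ∧
    ∀ i j, L.1 i = true → L.1 j = true → (SameBlock L i j ↔ c i = c j)

/-- The canonical form of a labelling: ones are labelled by the first row with the same label,
counted from `1`. -/
def normalize {k : ℕ} (c : Fin k → ℕ) (i : Fin k) : ℕ :=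
  if c i = 0 then 0 else (List.finRange k).findIdx (fun j => decide (c j = c i)) + 1

open Classical in
/-- The canonical labelling of a letter. -/
noncomputable def code {k : ℕ} (L : Letter k) (i : Fin k) : ℕ :=
  if L.1 i = true then (List.finRange k).findIdx (fun j => decide (SameBlock L j i)) + 1 else 0

theorem Labels.code_eq {k : ℕ} {c : Fin k → ℕ} {L : Letter k} (h : Labels c L) :
    code L = normalize c := by
  funext i
  have hi := h.1 i
  by_cases hc : c i = 0
  · rw [code, normalize, if_pos hc, if_neg (by simp [hi, hc])]
  · have hLi : L.1 i = true := by simp [hi, hc]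
    rw [code, normalize, if_neg hc, if_pos hLi]
    congr 2
    funext j
    rw [decide_eq_decide]
    by_cases hLj : L.1 j = true
    · exact h.2 j i hLj hLi
    · refine iff_of_false (fun h' => hLj h'.eq_true.1) fun e => hLj ?_
      rw [h.1, e]
      simp [hc]

theorem SameBlock.trans {k : ℕ} {L : Letter k} {i j l : Fin k} (h : SameBlock L i j)
    (h' : SameBlock L j l) : SameBlock L i l := by
  rw [sameBlock_iff_part_eq L h.eq_true.1 h'.eq_true.2]
  exact ((sameBlock_iff_part_eq L h.eq_true.1 h.eq_true.2).1 h).trans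
    ((sameBlock_iff_part_eq L h'.eq_true.1 h'.eq_true.2).1 h')

theorem labels_code {k : ℕ} (L : Letter k) : Labels (code L) L := by
  classical
  refine ⟨fun i => ?_, fun i j hi hj => ?_⟩
  · by_cases h : L.1 i = true <;> simp [code, h]
  · rw [code, code, if_pos hi, if_pos hj, Nat.add_right_cancel_iff]
    have hfind : ∀ i, L.1 i = true → ∃ l : Fin k,
        l.val = (List.finRange k).findIdx (fun j => decide (SameBlock L j i)) ∧
          SameBlock L l i := by
      intro i hi
      have hlt : (List.finRange k).findIdx (fun j => decide (SameBlock L j i)) <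
          (List.finRange k).length := by
        rw [List.findIdx_lt_length]
        exact ⟨i, List.mem_finRange i,
          decide_eq_true ((sameBlock_iff_part_eq L hi hi).2 rfl)⟩
      have := List.findIdx_getElem (w := hlt)
      rw [decide_eq_true_iff] at this
      exact ⟨_, by simp, this⟩
    constructor
    · intro h
      congr 1
      funext l
      rw [decide_eq_decide]
      exact ⟨fun h' => h'.trans h, fun h' => h'.trans h.symm⟩
    · intro h
      obtain ⟨l, hl, hli⟩ := hfind i hi
      obtain ⟨l', hl', hlj⟩ := hfind j hj
      obtain rfl : l = l' := Fin.ext (by rw [hl, hl', h])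
      exact hli.symm.trans hlj

/-- The edges of the merge graph: positions of the new column are `Sum.inl i`, and `Sum.inr i`
stands for the block of the old letter that contains the position `i`. -/
def mergeEdges {k : ℕ} (u v : Fin k → Bool) : List ((Fin k ⊕ Fin k) × (Fin k ⊕ Fin k)) :=
  ((List.finRange k ×ˢ List.finRange k).filter
      fun p => p.1.val + 1 = p.2.val && v p.1 && v p.2).map (fun p => (Sum.inl p.1, Sum.inl p.2)) ++
    ((List.finRange k).filter fun i => u i && v i).map fun i => (Sum.inl i, Sum.inr i)

theorem mem_mergeEdges {k : ℕ} {u v : Fin k → Bool}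
    {p : (Fin k ⊕ Fin k) × (Fin k ⊕ Fin k)} :
    p ∈ mergeEdges u v ↔
      (∃ i j : Fin k, i.val + 1 = j.val ∧ v i = true ∧ v j = true ∧
        (Sum.inl i, Sum.inl j) = p) ∨
      ∃ i, u i = true ∧ v i = true ∧ (Sum.inl i, Sum.inr i) = p := by
  simp only [mergeEdges, List.mem_append, List.mem_map, List.mem_filter, List.mem_product,
    List.mem_finRange, Bool.and_eq_true, decide_eq_true_eq, Prod.exists, true_and, and_assoc]

/-- The vertex of the merge graph represented by a position. -/
def mergeVertex {k : ℕ} (L : Letter k) : Fin k ⊕ Fin k → Fin k ⊕ Finset (Fin k) :=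
  Sum.map id L.2.part

theorem addEdges_bot_mergeEdges {k : ℕ} (L : Letter k) (v : Fin k → Bool) :
    addEdges ⊥ (mergeVertex L) (mergeEdges L.1 v) = mergeGraph L v := by
  ext x y
  rw [addEdges_adj, mergeGraph_adj]
  constructor
  · rintro (h | ⟨-, p, hp, hpe⟩)
    · exact h.elim
    · rw [mem_mergeEdges] at hp
      rw [Sym2.eq_iff] at hpe
      rcases hp with ⟨i, j, hij, hi, hj, rfl⟩ | ⟨i, hu, hv, rfl⟩
      · refine Or.inl ⟨i, j, hij, hi, hj, ?_⟩
        rcases hpe with ⟨rfl, rfl⟩ | ⟨rfl, rfl⟩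
        · exact Or.inl ⟨rfl, rfl⟩
        · exact Or.inr ⟨rfl, rfl⟩
      · refine Or.inr ⟨i, hu, hv, ?_⟩
        rcases hpe with ⟨rfl, rfl⟩ | ⟨rfl, rfl⟩
        · exact Or.inl ⟨rfl, rfl⟩
        · exact Or.inr ⟨rfl, rfl⟩
  · rintro (⟨i, j, hij, hi, hj, hxy⟩ | ⟨i, hu, hv, hxy⟩)
    · have hne : (Sum.inl i : Fin k ⊕ Finset (Fin k)) ≠ Sum.inl j := fun e => by
        rw [Sum.inl.inj e] at hij
        omega
      refine Or.inr ⟨?_, _, mem_mergeEdges.2 (Or.inl ⟨i, j, hij, hi, hj, rfl⟩), ?_⟩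
      · rcases hxy with ⟨rfl, rfl⟩ | ⟨rfl, rfl⟩
        · exact hne
        · exact hne.symm
      · rw [Sym2.eq_iff]
        rcases hxy with ⟨rfl, rfl⟩ | ⟨rfl, rfl⟩
        · exact Or.inl ⟨rfl, rfl⟩
        · exact Or.inr ⟨rfl, rfl⟩
    · refine Or.inr ⟨?_, _, mem_mergeEdges.2 (Or.inr ⟨i, hu, hv, rfl⟩), ?_⟩
      · rcases hxy with ⟨rfl, rfl⟩ | ⟨rfl, rfl⟩
        · exact Sum.inl_ne_inr
        · exact Sum.inr_ne_inl
      · rw [Sym2.eq_iff]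
        rcases hxy with ⟨rfl, rfl⟩ | ⟨rfl, rfl⟩
        · exact Or.inl ⟨rfl, rfl⟩
        · exact Or.inr ⟨rfl, rfl⟩

theorem nodup_mergeEdges {k : ℕ} (u v : Fin k → Bool) : (mergeEdges u v).Nodup := by
  rw [mergeEdges, List.nodup_append]
  refine ⟨?_, ?_, ?_⟩
  · refine (((List.nodup_finRange k).product (List.nodup_finRange k)).filter _).map ?_
    intro p q h
    simp only [Prod.mk.injEq, Sum.inl.injEq] at h
    exact Prod.ext h.1 h.2
  · refine ((List.nodup_finRange k).filter _).map ?_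
    intro p q h
    simp only [Prod.mk.injEq, Sum.inl.injEq] at h
    exact h.1
  · intro p hp q hq
    simp only [List.mem_map] at hp hq
    obtain ⟨p, -, rfl⟩ := hp
    obtain ⟨q, -, rfl⟩ := hq
    simp

theorem nodup_map_mergeEdges {k : ℕ} (L : Letter k) (v : Fin k → Bool) :
    ((mergeEdges L.1 v).map fun p => s(mergeVertex L p.1, mergeVertex L p.2)).Nodup := by
  refine (nodup_mergeEdges L.1 v).map_on fun p hp q hq hpq => ?_
  rw [mem_mergeEdges] at hp hq
  rcases hp with ⟨i, j, hij, -, -, rfl⟩ | ⟨i, -, -, rfl⟩ <;>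
    rcases hq with ⟨i', j', hij', -, -, rfl⟩ | ⟨i', -, -, rfl⟩ <;>
    simp only [mergeVertex, Sum.map_inl, Sum.map_inr, id_eq, Sym2.eq_iff, Sum.inl.injEq,
      Sum.inr.injEq, reduceCtorEq, and_false, false_and, or_self, or_false] at hpq
  · rcases hpq with ⟨rfl, rfl⟩ | ⟨rfl, rfl⟩
    · rfl
    · omega
  · rw [hpq.1]

/-- The labels before any merging: the positions of the new column are pairwise distinct, and
distinct from the blocks of the old letter. -/
def initialLabels {k : ℕ} (c : Fin k → ℕ) : Fin k ⊕ Fin k → ℕ :=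
  Sum.elim (fun i => i.val + 1) fun i => if c i = 0 then 0 else k + c i

theorem Labels.initialLabels_eq_iff {k : ℕ} {c : Fin k → ℕ} {L : Letter k} (h : Labels c L)
    (a b : Fin k ⊕ Fin k) :
    initialLabels c a = initialLabels c b ↔ mergeVertex L a = mergeVertex L b := by
  have hpart : ∀ i, c i = 0 → L.2.part i = ∅ := fun i hi => by
    rw [Finpartition.part_eq_empty]
    simp [h.1, hi]
  have hpart' : ∀ i, c i ≠ 0 → i ∈ L.2.part i := fun i hi =>
    L.mem_part (by simp [h.1, hi])
  rcases a with i | i <;> rcases b with j | j <;>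
    simp only [initialLabels, mergeVertex, Sum.elim_inl, Sum.elim_inr, Sum.map_inl, Sum.map_inr,
      Sum.inl.injEq, Sum.inr.injEq, reduceCtorEq, id_eq, iff_false]
  · rw [Fin.ext_iff]
    omega
  · have := i.isLt
    by_cases hj : c j = 0
    · rw [if_pos hj]
      exact Nat.succ_ne_zero _
    · rw [if_neg hj]
      exact fun _ => by omega
  · have := j.isLt
    by_cases hi : c i = 0
    · rw [if_pos hi]
      exact (Nat.succ_ne_zero _).symm
    · rw [if_neg hi]
      exact fun _ => by omega
  · by_cases hi : c i = 0 <;> by_cases hj : c j = 0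
    · simp [hi, hj, hpart]
    · rw [if_pos hi, if_neg hj, hpart i hi]
      refine iff_of_false (by omega) fun e => ?_
      have := hpart' j hj
      rw [← e] at this
      simp at this
    · rw [if_neg hi, if_pos hj, hpart j hj]
      refine iff_of_false (by omega) fun e => ?_
      have := hpart' i hi
      rw [e] at this
      simp at this
    · have hLi : L.1 i = true := by simp [h.1, hi]
      have hLj : L.1 j = true := by simp [h.1, hj]
      rw [if_neg hi, if_neg hj, ← sameBlock_iff_part_eq L hLi hLj, h.2 i j hLi hLj]
      omega

instance (p q r s : Bool) : Decidable (Window p q r s) :=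
  inferInstanceAs (Decidable (¬ (p = q ∧ q = r ∧ r = s) ∧ ¬ (p = s ∧ q = r ∧ p ≠ q)))

/-- The canonical labelling of the follower with column `v` of a letter labelled by `c`, if there
is such a follower. -/
def nextCode {k : ℕ} (c : Fin k → ℕ) (v : Fin k → Bool) : Option (Fin k → ℕ) :=
  let u : Fin k → Bool := fun i => decide (c i ≠ 0)
  if (∀ a ≤ k, Window (padCol u a) (padCol v a) (padCol u (a + 1)) (padCol v (a + 1))) ∧
      ∀ i, c i ≠ 0 → ∃ j, c j = c i ∧ v j = true then
    (joinLabels (initialLabels c) (mergeEdges u v)).map fun f =>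
      normalize fun i => if v i = true then f (Sum.inl i) + 1 else 0
  else none

theorem Labels.nextCode_eq_some_iff {k : ℕ} {c : Fin k → ℕ} {L : Letter k} (h : Labels c L)
    (v : Fin k → Bool) (c' : Fin k → ℕ) :
    nextCode c v = some c' ↔ ∃ L' : Letter k, L'.1 = v ∧ Follows L L' ∧ code L' = c' := by
  have hu : (fun i => decide (c i ≠ 0)) = L.1 := (funext h.1).symm
  have hrel : ∀ a b, initialLabels c a = initialLabels c b ↔
      (⊥ : SimpleGraph (Fin k ⊕ Finset (Fin k))).Reachable (mergeVertex L a) (mergeVertex L b) :=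
    fun a b => by rw [reachable_bot, h.initialLabels_eq_iff]
  have hacyc := isAcyclic_addEdges_iff ⊥ (mergeVertex L)
    (fun a b => initialLabels c a = initialLabels c b) hrel (mergeEdges L.1 v)
    (by
      intro p hp
      rcases mem_mergeEdges.1 hp with ⟨i, j, hij, -, -, rfl⟩ | ⟨i, -, -, rfl⟩
      · intro e
        have : i = j := Sum.inl.inj e
        rw [this] at hij
        omega
      · exact Sum.inl_ne_inr)
    (fun _ _ h => h.elim) (nodup_map_mergeEdges L v)
  have hreach := joinList_iff_reachable ⊥ (mergeVertex L)
    (fun a b => initialLabels c a = initialLabels c b) hrel (mergeEdges L.1 v)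
  rw [addEdges_bot_mergeEdges] at hacyc hreach
  obtain ⟨hj1, hj2⟩ := joinLabels_spec (initialLabels c)
    (fun a b => initialLabels c a = initialLabels c b) (fun _ _ => Iff.rfl) (mergeEdges L.1 v)
  rw [hj1] at hacyc
  have hcont : (∀ i, c i ≠ 0 → ∃ j, c j = c i ∧ v j = true) ↔
      ∀ B ∈ L.2.parts, ∃ i ∈ B, v i = true := by
    constructor
    · intro h' B hB
      obtain ⟨i, hi⟩ := L.2.nonempty_of_mem_parts hB
      have hLi := Letter.eq_true_of_mem hB hi
      have hci : c i ≠ 0 := by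
        rw [h.1] at hLi
        exact of_decide_eq_true hLi
      obtain ⟨j, hj, hvj⟩ := h' i hci
      have hLj : L.1 j = true := by rw [h.1, hj, ← h.1, hLi]
      obtain ⟨C, hC, h1, h2⟩ := (h.2 j i hLj hLi).2 hj
      refine ⟨j, ?_, hvj⟩
      rwa [Letter.eq_part hB hi, ← Letter.eq_part hC h2]
    · intro h' i hi
      have hLi : L.1 i = true := by simp [h.1, hi]
      obtain ⟨j, hj, hvj⟩ := h' _ (L.part_mem hLi)
      have hLj := Letter.eq_true_of_mem (L.part_mem hLi) hj
      exact ⟨j, (h.2 j i hLj hLi).1 ⟨_, L.part_mem hLi, hj, L.mem_part hLi⟩, hvj⟩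
  -- labels of the new column that describe any letter with the right blocks
  have hlabels : ∀ (f : Fin k ⊕ Fin k → ℕ) (L' : Letter k),
      joinLabels (initialLabels c) (mergeEdges L.1 v) = some f → L'.1 = v →
      (∀ i j, v i = true → v j = true → (SameBlock L' i j ↔
        (mergeGraph L v).Reachable (Sum.inl i) (Sum.inl j))) →
      Labels (fun i => if v i = true then f (Sum.inl i) + 1 else 0) L' := by
    rintro f L' hf rfl hblock
    refine ⟨fun i => ?_, fun i j hi hj => ?_⟩
    · by_cases hi : L'.1 i = true <;> simp [hi]
    · beta_reduce
      rw [hblock i j hi hj, if_pos hi, if_pos hj, Nat.add_right_cancel_iff,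
        ← hj2 f hf (Sum.inl i) (Sum.inl j)]
      exact (hreach (Sum.inl i) (Sum.inl j)).symm
  rw [nextCode]
  simp only [hu, hcont]
  constructor
  · intro h'
    split_ifs at h' with hcond
    obtain ⟨f, hf, rfl⟩ := Option.map_eq_some_iff.1 h'
    obtain ⟨L', rfl, hblock⟩ := exists_letter v
      ((mergeGraph L v).reachableSetoid.comap (Sum.inl : Fin k → Fin k ⊕ Finset (Fin k)))
    exact ⟨L', rfl, ⟨hcond.1, hacyc.2 ⟨isAcyclic_bot, by rw [hf]; rfl⟩, hcond.2, hblock⟩,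
      (hlabels f L' hf rfl hblock).code_eq⟩
  · rintro ⟨L', rfl, ⟨h1, h2, h3, h4⟩, rfl⟩
    rw [if_pos ⟨h1, h3⟩]
    obtain ⟨f, hf⟩ := Option.isSome_iff_exists.1 (hacyc.1 h2).2
    rw [hf, Option.map_some, (hlabels f L' hf rfl h4).code_eq]

/-- The condition on a labelling for the letter to be an ender. -/
def IsEndCode {k : ℕ} (c : Fin k → ℕ) : Prop :=
  (∀ a ≤ k, Window (padCol (fun i => decide (c i ≠ 0)) a) false
    (padCol (fun i => decide (c i ≠ 0)) (a + 1)) false) ∧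
  ∃ i, c i ≠ 0 ∧ ∀ j, c j ≠ 0 → c j = c i

instance {k : ℕ} (c : Fin k → ℕ) : Decidable (IsEndCode c) :=
  inferInstanceAs (Decidable (_ ∧ _))

theorem Labels.isEnder_iff {k : ℕ} {c : Fin k → ℕ} {L : Letter k} (h : Labels c L) :
    IsEnder L ↔ IsEndCode c := by
  rw [IsEnder, IsEndCode, show (fun i => decide (c i ≠ 0)) = L.1 from (funext h.1).symm]
  refine and_congr_right fun _ => ?_
  have hL : ∀ i, c i ≠ 0 ↔ L.1 i = true := fun i => by simp [h.1]
  simp only [hL]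
  rw [Finset.card_eq_one]
  constructor
  · rintro ⟨B, hB⟩
    have hBm : B ∈ L.2.parts := by simp [hB]
    obtain ⟨i, hi⟩ := L.2.nonempty_of_mem_parts hBm
    have hLi := Letter.eq_true_of_mem hBm hi
    refine ⟨i, hLi, fun j hj => (h.2 j i hj hLi).1 ?_⟩
    have hjB := L.part_mem hj
    rw [hB, Finset.mem_singleton] at hjB
    exact ⟨B, hBm, hjB ▸ L.mem_part hj, hi⟩
  · rintro ⟨i, hi, hi'⟩
    refine ⟨L.2.part i, Finset.eq_singleton_iff_unique_mem.2 ⟨L.part_mem hi, fun C hC => ?_⟩⟩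
    obtain ⟨j, hj⟩ := L.2.nonempty_of_mem_parts hC
    have hLj := Letter.eq_true_of_mem hC hj
    rw [Letter.eq_part hC hj, ← sameBlock_iff_part_eq L hLj hi]
    exact (h.2 j i hLj hi).2 (hi' j hLj)

/-! ### Quotients of the transfer system -/

/-- The canonical labellings of the followers of a letter with labelling `c`. -/
def nextCodes {k : ℕ} (c : Fin k → ℕ) : Multiset (Fin k → ℕ) :=
  Finset.univ.val.filterMap (nextCode c)

theorem mem_nextCodes_code {k : ℕ} {L L' : Letter k} (h : Follows L L') :
    code L' ∈ nextCodes (code L) :=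
  (Multiset.mem_filterMap _ _).2 ⟨L'.1, Finset.mem_univ _,
    ((labels_code L).nextCode_eq_some_iff _ _).2 ⟨L', rfl, h, rfl⟩⟩

open Classical in
theorem sum_follows_eq_sum_nextCodes {k : ℕ} {K : Type*} [AddCommMonoid K] (L : Letter k)
    (g : (Fin k → ℕ) → K) :
    ∑ L' : Letter k, (if Follows L L' then g (code L') else 0) =
      ((nextCodes (code L)).map g).sum := by
  have hfilter : ∀ s : Multiset (Fin k → Bool), ((s.filterMap (nextCode (code L))).map g).sum =
      (s.map fun v => (nextCode (code L) v).elim 0 g).sum := by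
    intro s
    induction s using Multiset.induction_on with
    | empty => simp
    | cons v s ih =>
      rw [Multiset.map_cons, Multiset.sum_cons, ← ih]
      cases h : nextCode (code L) v with
      | none => rw [Multiset.filterMap_cons_none _ _ h, Option.elim_none, zero_add]
      | some c' =>
        rw [Multiset.filterMap_cons_some _ _ _ h, Option.elim_some, Multiset.map_cons,
          Multiset.sum_cons]
  rw [nextCodes, hfilter, Fintype.sum_sigma]
  refine Finset.sum_congr rfl fun v _ => ?_
  have hnext := (labels_code L).nextCode_eq_some_iff v
  cases h : nextCode (code L) v with
  | none =>
    refine Finset.sum_eq_zero fun S _ => if_neg fun hS => ?_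
    have := (hnext _).2 ⟨⟨v, S⟩, rfl, hS, rfl⟩
    rw [h] at this
    exact Option.noConfusion rfl (heq_of_eq this)
  | some c' =>
    obtain ⟨⟨v, S⟩, rfl, hS, rfl⟩ := (hnext _).1 h
    rw [Finset.sum_eq_single_of_mem S (Finset.mem_univ S), if_pos hS, Option.elim_some]
    refine fun S' _ hne => if_neg fun hS' => hne ?_
    exact eq_of_heq (Sigma.mk.inj (hS'.unique hS rfl)).2

theorem code_zeroLetter (k : ℕ) : code (zeroLetter k) = fun _ => 0 :=
  funext fun i => by simp [code, zeroLetter]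

/-- The index of the class containing a labelling. -/
def classIdx {k : ℕ} (C : List (List (Fin k → ℕ))) (c : Fin k → ℕ) : ℕ :=
  C.findIdx fun D => decide (c ∈ D)

/-- The classes `C` of labellings of letters form an equitable partition of the transfer graph:
all the members of the class with index `p` are alike in being enders or not, as `fin p` tells, and
have followers in the classes listed, with multiplicity, in `row p`. -/
def IsEquitable {k : ℕ} (C : List (List (Fin k → ℕ))) (fin : ℕ → Bool) (row : ℕ → List ℕ) : Prop :=
  (∀ D ∈ C, ∀ c ∈ D, decide (IsEndCode c) = fin (classIdx C c) ∧
    (nextCodes c).map (classIdx C) = row (classIdx C c)) ∧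
  ∀ p < C.length, ∀ q ∈ row p, q < C.length

instance {k : ℕ} (C : List (List (Fin k → ℕ))) (fin : ℕ → Bool) (row : ℕ → List ℕ) :
    Decidable (IsEquitable C fin row) :=
  inferInstanceAs (Decidable (_ ∧ _))

/-- The linear system for the generating function may be solved with one unknown for each class of
an equitable partition. The column of zeros takes part as a letter whose followers are the
starters. -/
theorem GFnz_eq_of_isEquitable {k : ℕ} {C : List (List (Fin k → ℕ))} {fin : ℕ → Bool}
    {row : ℕ → List ℕ} (hC : IsEquitable C fin row)
    (h0 : classIdx C (fun _ => 0) < C.length) (y : ℕ → RatFunc ℚ)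
    (hy : ∀ p < C.length, y p =
      RatFunc.X * ((if fin p = true then 1 else 0) + ((row p).map y).sum)) :
    GFnz (k + 1) = y (classIdx C fun _ => 0) := by
  classical
  have hmem : ∀ c, classIdx C c < C.length → decide (IsEndCode c) = fin (classIdx C c) ∧
      (nextCodes c).map (classIdx C) = row (classIdx C c) := by
    intro c hc
    obtain ⟨D, hD, hcD⟩ := List.findIdx_lt_length.1 hc
    exact hC.1 D hD c (of_decide_eq_true hcD)
  have hstep : ∀ L L' : Letter k, classIdx C (code L) < C.length → Follows L L' →
      classIdx C (code L') < C.length := by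
    intro L L' hL h
    refine hC.2 _ hL _ ?_
    rw [← Multiset.mem_coe, ← (hmem _ hL).2]
    exact Multiset.mem_map_of_mem _ (mem_nextCodes_code h)
  have hsum : ∀ L : Letter k, classIdx C (code L) < C.length →
      y (classIdx C (code L)) = RatFunc.X * ((if IsEnder L then 1 else 0) +
        ∑ L' : Letter k, if Follows L L' then y (classIdx C (code L')) else 0) := by
    intro L hL
    rw [hy _ hL, sum_follows_eq_sum_nextCodes L fun c => y (classIdx C c), ← (hmem _ hL).1,
      ← Multiset.sum_coe, ← Multiset.map_coe, ← (hmem _ hL).2, Multiset.map_map]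
    simp only [decide_eq_true_eq, (labels_code L).isEnder_iff, Function.comp_def]
  rw [← code_zeroLetter] at h0 ⊢
  have := map_GFnz (RingHom.id _) (fun L => y (classIdx C (code L))) (by
    rintro L ⟨S, hS, hSL⟩
    refine hsum L ?_
    induction hSL with
    | refl => exact hstep _ _ h0 ((isStarter_iff_follows S).1 hS)
    | tail _ h ih => exact hstep _ _ ih h)
  rw [hsum _ h0, if_neg (not_isEnder_zeroLetter k), zero_add]
  exact this

/-! ### The generating functions of widths four and five -/

theorem algebraMap_ratFunc_ne_zero_of_eval_ne_zero {p : Polynomial ℚ} (a : ℚ) (h : p.eval a ≠ 0) :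
    algebraMap (Polynomial ℚ) (RatFunc ℚ) p ≠ 0 :=
  RatFunc.algebraMap_ne_zero fun e => h (by rw [e, Polynomial.eval_zero])

theorem GFnz_four : GFnz 4 =
    -(RatFunc.X ^ 2 /
      (RatFunc.X ^ 4 - 2 * RatFunc.X ^ 3 + 2 * RatFunc.X ^ 2 + 2 * RatFunc.X - 1)) := by
  have hd : (RatFunc.X ^ 4 - 2 * RatFunc.X ^ 3 + 2 * RatFunc.X ^ 2 + 2 * RatFunc.X - 1 :
      RatFunc ℚ) ≠ 0 := by
    have := algebraMap_ratFunc_ne_zero_of_eval_ne_zero (p := Polynomial.X ^ 4 - 2 * Polynomial.X ^ 3 +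
      2 * Polynomial.X ^ 2 + 2 * Polynomial.X - 1) 0 (by simp)
    simpa [map_ofNat] using this
  set d : RatFunc ℚ :=
    RatFunc.X ^ 4 - 2 * RatFunc.X ^ 3 + 2 * RatFunc.X ^ 2 + 2 * RatFunc.X - 1 with hd'
  -- the canonical labellings of the reachable letters, grouped by equal generating functions; the
  -- first class is that of the column of zeros, and the values are the solution of the system
  have h := GFnz_eq_of_isEquitable (k := 3)
    (C := [[![0, 0, 0], ![1, 0, 3], ![1, 0, 0], ![0, 0, 3]], [![1, 1, 1]], [![1, 0, 1]],
      [![0, 2, 0]]])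
    (fin := fun p => [false, true, true, false].getD p false)
    (row := fun p => [[1, 0], [2, 0, 3, 0], [2, 0, 0], [1]].getD p [])
    (by decide +kernel) (by decide +kernel)
    (fun p => [-RatFunc.X ^ 2 / d, (-RatFunc.X + RatFunc.X ^ 2) / d,
      (-RatFunc.X + RatFunc.X ^ 2 + RatFunc.X ^ 3 - RatFunc.X ^ 4) / d,
      (-RatFunc.X ^ 2 + RatFunc.X ^ 3) / d].getD p 0)
    (by
      intro p hp
      replace hp : p < 4 := hp
      interval_cases p <;> simp <;> field_simp <;> (try rw [hd']) <;> ring)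
  refine h.trans ?_
  rw [show classIdx _ _ = 0 by decide +kernel, List.getD_cons_zero, neg_div]

/-- Width five is treated like width four, with seven classes of letters. -/
theorem GFnz_five : GFnz 5 =
    -(RatFunc.X ^ 2 * (3 * RatFunc.X ^ 2 + 1) /
      (2 * RatFunc.X ^ 6 + 11 * RatFunc.X ^ 2 - 1)) := by
  have hd : (2 * RatFunc.X ^ 6 + 11 * RatFunc.X ^ 2 - 1 : RatFunc ℚ) ≠ 0 := by
    have := algebraMap_ratFunc_ne_zero_of_eval_ne_zero
      (p := 2 * Polynomial.X ^ 6 + 11 * Polynomial.X ^ 2 - 1) 0 (by simp)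
    simpa [map_ofNat] using this
  set d : RatFunc ℚ := 2 * RatFunc.X ^ 6 + 11 * RatFunc.X ^ 2 - 1 with hd'
  have h := GFnz_eq_of_isEquitable (k := 4)
    (C := [[![0, 0, 0, 0], ![1, 0, 0, 0], ![0, 0, 0, 4], ![1, 0, 0, 4]], [![1, 1, 1, 1]],
      [![1, 1, 0, 4], ![1, 0, 3, 3], ![0, 0, 3, 3], ![1, 1, 0, 0]],
      [![1, 0, 1, 0], ![0, 2, 0, 2], ![0, 2, 2, 2], ![1, 1, 1, 0]], [![1, 0, 0, 1]],
      [![0, 2, 0, 0], ![0, 0, 3, 0], ![0, 2, 0, 4], ![1, 0, 3, 0]],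
      [![1, 0, 1, 1], ![1, 1, 0, 1]]])
    (fin := fun p => [false, true, false, false, false, false, true].getD p false)
    (row := fun p => [[1, 2, 2], [3, 4, 0, 3, 5, 5, 0], [0, 3, 5], [6, 2], [6, 2, 6, 2], [1, 2],
      [3, 4, 0, 5, 0]].getD p [])
    (by decide +kernel) (by decide +kernel)
    (fun p => [(-RatFunc.X ^ 2 - 3 * RatFunc.X ^ 4) / d,
      (-RatFunc.X + 3 * RatFunc.X ^ 3 + 2 * RatFunc.X ^ 5) / d,
      (-3 * RatFunc.X ^ 3 - RatFunc.X ^ 5) / d,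
      (-RatFunc.X ^ 2 + 2 * RatFunc.X ^ 4 - RatFunc.X ^ 6) / d,
      (-2 * RatFunc.X ^ 2 + 4 * RatFunc.X ^ 4 - 2 * RatFunc.X ^ 6) / d,
      (-RatFunc.X ^ 2 + RatFunc.X ^ 6) / d,
      (-RatFunc.X + 5 * RatFunc.X ^ 3) / d].getD p 0)
    (by
      intro p hp
      replace hp : p < 7 := hp
      interval_cases p <;> simp <;> field_simp <;> (try rw [hd']) <;> ring)
  refine h.trans ?_
  rw [show classIdx _ _ = 0 by decide +kernel, List.getD_cons_zero]
  ring

end GridHam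

theorem mainTheorem1 :
    (∀ m n : ℕ, 1 ≤ m → 1 ≤ n →
      Set.BijOn (GridHam.boundaryEdges (m := m) (n := n))
        {A | GridHam.IsGoodMatrix A}
        (GridHam.hamiltonianCycles (GridHam.gridGraph (m + 1) (n + 1)))) ∧
    (∀ m : ℕ, 2 ≤ m →
      ((GridHam.GFnz m : RatFunc ℚ) : LaurentSeries ℚ) =
        ((PowerSeries.mk fun n : ℕ => (GridHam.numHamCycles m n : ℚ) : PowerSeries ℚ) :
          LaurentSeries ℚ)) ∧
    GridHam.GFnz 4 =
      -(RatFunc.X ^ 2 /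
        (RatFunc.X ^ 4 - 2 * RatFunc.X ^ 3 + 2 * RatFunc.X ^ 2 + 2 * RatFunc.X - 1)) ∧
    GridHam.GFnz 5 =
      -(RatFunc.X ^ 2 * (3 * RatFunc.X ^ 2 + 1) /
        (2 * RatFunc.X ^ 6 + 11 * RatFunc.X ^ 2 - 1)) := by
  refine ⟨fun m n _ _ => GridHam.bijOn_boundaryEdges m n, fun m hm => ?_, GridHam.GFnz_four,
    GridHam.GFnz_five⟩
  obtain ⟨k, rfl⟩ := Nat.exists_eq_add_of_le' (one_le_two.trans hm)
  exact GridHam.coe_GFnz k
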